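/- Let $\mathcal V$ be a distributive monoidal category, that is, a symmetric monoidal category with all small coproducts over which the tensor product distributes separately in each variable. Let $\mathbb{M}\mathrm{at}(\mathcal V)$ be the (pseudo) double category of $\mathcal V$-matrices: its objects are sets, its arrows are functions, a proarrow $M : X \overset{|}{\to} Y$ is a family of objects $M(x,y)$ of $\mathcal V$ indexed by $X\times Y$, and a cell with top $M : X \overset{|}{\to} Y$, bottom $N : X' \overset{|}{\to} Y'$ and sides $f : X\to X'$, $g : Y\to Y'$ is a family of morphisms $M(x,y)\to N(f(x),g(y))$. Composition is $(M\odot N)(x,z)=\sum_{y} M(x,y)\otimes N(y,z)$, and the identity proarrow on $X$ has entries the monoidal unit if $x=x'$ and the initial object otherwise. For a double category $\mathbb D$, let $\mathbb{F}\mathrm{am}(\mathbb D)$ be the double category of families: an object is a set $I$ with objects $(x_i)_{i\in I}$ of $\mathbb D$; a proarrow $(I,\vec x) \overset{|}{\to} (J,\vec y)$ is a span of sets $I\xleftarrow{\ell}A\xrightarrow{r}J$ with proarrows $m_a : x_{\ell(a)} \overset{|}{\to} y_{r(a)}$, $a\in A$; arrows and cells are maps of indexing sets and spans together with families of arrows and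 cells of $\mathbb D$; proarrows are composed by pullback of spans and componentwise composition in $\mathbb D$. Let $\Delta:\mathbb D\to\mathbb{F}\mathrm{am}(\mathbb D)$ be the double functor sending objects and proarrows to singleton families. The double category $\mathbb D$ *has strong coproducts* if $\Delta$ has a left adjoint $\Sigma$ (in the 2-category of double categories, colax double functors and natural transformations) that is a pseudo double functor. **Proposition.** $\mathbb{M}\mathrm{at}(\mathcal V)$ has strong coproducts. Moreover, for every left adjoint $\Sigma$ of $\Delta$ as above (colax or pseudo), with unit components (coprojections) $\iota$: the coprojections $\iota_i : X_i\to\Sigma\vec X$ of a family of sets exhibit $\Sigma\vec X$ as the coproduct of the sets $X_i$; and for every family of matrices $(A,\vec M):(I,\vec X) \overset{|}{\to} (J,\vec Y)$ and all $i\in I$, $j\in J$, $x\in X_i$, $y\in Y_j$, the coprojections $$M_a(x,y)\longrightarrow (\Sigma\vec M)(\iota_i(x),\iota_j(y)),\qquad a\in A,\ \ell(a)=i,\ r(a)=j,$$ form a coproduct cocone in $\mathcal V$; that is, $(\Sigma\vec M)(\iota_i x,\iota_j y)\cong\sum_{a\,:\,\ell(a)=i,\ r(a)=j} M_a(x,y)$.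 -/

import Mathlib

open CategoryTheory CategoryTheory.Limits CategoryTheory.MonoidalCategory

attribute [-instance] CategoryTheory.catToReflQuiver

universe w u v p c u' v' p' c' u'' v'' p'' c''

/-! ### Pseudo double categories -/

/-- A (pseudo) double category.  Objects and arrows form a category, composed strictly;
proarrows `x ⇸ y` are composed (in diagrammatic order) up to coherent invertible globular cells.
A cell in `Cell f g m n` has left boundary `f`, right boundary `g`, top `m` and bottom `n`.
Equations between cells whose boundaries agree by a law of the category of objects and arrows
are written with `HEq`. -/
structure DblCat where
  /-- objects -/
  Obj : Type u
  /-- arrows and their composition -/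
  [cat : Category.{v} Obj]
  /-- proarrows -/
  Pro : Obj → Obj → Type p
  /-- cells -/
  Cell : ∀ {x x' y y' : Obj}, (x ⟶ x') → (y ⟶ y') → Pro x y → Pro x' y' → Type c
  /-- identity cell on a proarrow, for composition of cells in the direction of the arrows -/
  vid : ∀ {x y : Obj} (m : Pro x y), Cell (𝟙 x) (𝟙 y) m m
  /-- composition of cells in the direction of the arrows -/
  vcomp : ∀ {x x' x'' y y' y'' : Obj} {f : x ⟶ x'} {f' : x' ⟶ x''} {g : y ⟶ y'} {g' : y' ⟶ y''}
    {m : Pro x y} {m' : Pro x' y'} {m'' : Pro x'' y''},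
    Cell f g m m' → Cell f' g' m' m'' → Cell (f ≫ f') (g ≫ g') m m''
  /-- identity proarrow -/
  hid : ∀ x : Obj, Pro x x
  /-- external composition of proarrows -/
  hcomp : ∀ {x y z : Obj}, Pro x y → Pro y z → Pro x z
  /-- external identity cell on an arrow -/
  hidCell : ∀ {x x' : Obj} (f : x ⟶ x'), Cell f f (hid x) (hid x')
  /-- external composition of cells -/
  hcompCell : ∀ {x x' y y' z z' : Obj} {f : x ⟶ x'} {g : y ⟶ y'} {h : z ⟶ z'}
    {m : Pro x y} {m' : Pro x' y'} {n : Pro y z} {n' : Pro y' z'},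
    Cell f g m m' → Cell g h n n' → Cell f h (hcomp m n) (hcomp m' n')
  /-- associator -/
  assoc : ∀ {x y z t : Obj} (m : Pro x y) (n : Pro y z) (q : Pro z t),
    Cell (𝟙 x) (𝟙 t) (hcomp (hcomp m n) q) (hcomp m (hcomp n q))
  /-- inverse associator -/
  assocInv : ∀ {x y z t : Obj} (m : Pro x y) (n : Pro y z) (q : Pro z t),
    Cell (𝟙 x) (𝟙 t) (hcomp m (hcomp n q)) (hcomp (hcomp m n) q)
  /-- left unitor -/
  lunit : ∀ {x y : Obj} (m : Pro x y), Cell (𝟙 x) (𝟙 y) (hcomp (hid x) m) m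
  /-- inverse left unitor -/
  lunitInv : ∀ {x y : Obj} (m : Pro x y), Cell (𝟙 x) (𝟙 y) m (hcomp (hid x) m)
  /-- right unitor -/
  runit : ∀ {x y : Obj} (m : Pro x y), Cell (𝟙 x) (𝟙 y) (hcomp m (hid y)) m
  /-- inverse right unitor -/
  runitInv : ∀ {x y : Obj} (m : Pro x y), Cell (𝟙 x) (𝟙 y) m (hcomp m (hid y))
  vid_vcomp : ∀ {x x' y y' : Obj} {f : x ⟶ x'} {g : y ⟶ y'} {m : Pro x y} {m' : Pro x' y'}
    (α : Cell f g m m'), HEq (vcomp (vid m) α) α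
  vcomp_vid : ∀ {x x' y y' : Obj} {f : x ⟶ x'} {g : y ⟶ y'} {m : Pro x y} {m' : Pro x' y'}
    (α : Cell f g m m'), HEq (vcomp α (vid m')) α
  vcomp_vcomp : ∀ {x₀ x₁ x₂ x₃ y₀ y₁ y₂ y₃ : Obj}
    {f : x₀ ⟶ x₁} {f' : x₁ ⟶ x₂} {f'' : x₂ ⟶ x₃} {g : y₀ ⟶ y₁} {g' : y₁ ⟶ y₂} {g'' : y₂ ⟶ y₃}
    {m₀ : Pro x₀ y₀} {m₁ : Pro x₁ y₁} {m₂ : Pro x₂ y₂} {m₃ : Pro x₃ y₃}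
    (α : Cell f g m₀ m₁) (β : Cell f' g' m₁ m₂) (γ : Cell f'' g'' m₂ m₃),
    HEq (vcomp (vcomp α β) γ) (vcomp α (vcomp β γ))
  hcompCell_vid : ∀ {x y z : Obj} (m : Pro x y) (n : Pro y z),
    hcompCell (vid m) (vid n) = vid (hcomp m n)
  hcompCell_vcomp : ∀ {x x' x'' y y' y'' z z' z'' : Obj}
    {f : x ⟶ x'} {f' : x' ⟶ x''} {g : y ⟶ y'} {g' : y' ⟶ y''} {h : z ⟶ z'} {h' : z' ⟶ z''}
    {m : Pro x y} {m' : Pro x' y'} {m'' : Pro x'' y''}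
    {n : Pro y z} {n' : Pro y' z'} {n'' : Pro y'' z''}
    (α : Cell f g m m') (α' : Cell f' g' m' m'') (β : Cell g h n n') (β' : Cell g' h' n' n''),
    hcompCell (vcomp α α') (vcomp β β') = vcomp (hcompCell α β) (hcompCell α' β')
  hidCell_id : ∀ x : Obj, hidCell (𝟙 x) = vid (hid x)
  hidCell_comp : ∀ {x x' x'' : Obj} (f : x ⟶ x') (f' : x' ⟶ x''),
    hidCell (f ≫ f') = vcomp (hidCell f) (hidCell f')
  assoc_assocInv : ∀ {x y z t : Obj} (m : Pro x y) (n : Pro y z) (q : Pro z t),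
    HEq (vcomp (assoc m n q) (assocInv m n q)) (vid (hcomp (hcomp m n) q))
  assocInv_assoc : ∀ {x y z t : Obj} (m : Pro x y) (n : Pro y z) (q : Pro z t),
    HEq (vcomp (assocInv m n q) (assoc m n q)) (vid (hcomp m (hcomp n q)))
  lunit_lunitInv : ∀ {x y : Obj} (m : Pro x y),
    HEq (vcomp (lunit m) (lunitInv m)) (vid (hcomp (hid x) m))
  lunitInv_lunit : ∀ {x y : Obj} (m : Pro x y), HEq (vcomp (lunitInv m) (lunit m)) (vid m)
  runit_runitInv : ∀ {x y : Obj} (m : Pro x y),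
    HEq (vcomp (runit m) (runitInv m)) (vid (hcomp m (hid y)))
  runitInv_runit : ∀ {x y : Obj} (m : Pro x y), HEq (vcomp (runitInv m) (runit m)) (vid m)
  assoc_naturality : ∀ {x x' y y' z z' t t' : Obj}
    {f : x ⟶ x'} {g : y ⟶ y'} {h : z ⟶ z'} {k : t ⟶ t'}
    {m : Pro x y} {m' : Pro x' y'} {n : Pro y z} {n' : Pro y' z'} {q : Pro z t} {q' : Pro z' t'}
    (α : Cell f g m m') (β : Cell g h n n') (γ : Cell h k q q'),
    HEq (vcomp (hcompCell (hcompCell α β) γ) (assoc m' n' q'))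
      (vcomp (assoc m n q) (hcompCell α (hcompCell β γ)))
  lunit_naturality : ∀ {x x' y y' : Obj} {f : x ⟶ x'} {g : y ⟶ y'}
    {m : Pro x y} {m' : Pro x' y'} (α : Cell f g m m'),
    HEq (vcomp (hcompCell (hidCell f) α) (lunit m')) (vcomp (lunit m) α)
  runit_naturality : ∀ {x x' y y' : Obj} {f : x ⟶ x'} {g : y ⟶ y'}
    {m : Pro x y} {m' : Pro x' y'} (α : Cell f g m m'),
    HEq (vcomp (hcompCell α (hidCell g)) (runit m')) (vcomp (runit m) α)
  pentagon : ∀ {x y z t s : Obj} (m : Pro x y) (n : Pro y z) (q : Pro z t) (r : Pro t s),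
    HEq (vcomp (assoc (hcomp m n) q r) (assoc m n (hcomp q r)))
      (vcomp (hcompCell (assoc m n q) (vid r))
        (vcomp (assoc m (hcomp n q) r) (hcompCell (vid m) (assoc n q r))))
  triangle : ∀ {x y z : Obj} (m : Pro x y) (n : Pro y z),
    HEq (vcomp (assoc m (hid y) n) (hcompCell (vid m) (lunit n)))
      (hcompCell (runit m) (vid n))

attribute [instance] DblCat.cat

namespace DblCat

section Cells

variable {D : DblCat.{u, v, p, c}}

/-- Replace the arrows in the boundary of a cell by equal ones. -/
def castCell {x x' y y' : D.Obj} {f f' : x ⟶ x'} {g g' : y ⟶ y'} {m : D.Pro x y}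
    {m' : D.Pro x' y'} (hf : f = f') (hg : g = g') (α : D.Cell f g m m') : D.Cell f' g' m m' :=
  cast (by rw [hf, hg]) α

lemma castCell_heq {x x' y y' : D.Obj} {f f' : x ⟶ x'} {g g' : y ⟶ y'} {m : D.Pro x y}
    {m' : D.Pro x' y'} (hf : f = f') (hg : g = g') (α : D.Cell f g m m') :
    HEq (castCell hf hg α) α :=
  cast_heq _ _

lemma vcomp_congr {x x' x'' y y' y'' : D.Obj} {f₁ f₂ : x ⟶ x'} {f₁' f₂' : x' ⟶ x''}
    {g₁ g₂ : y ⟶ y'} {g₁' g₂' : y' ⟶ y''}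
    {m : D.Pro x y} {m' : D.Pro x' y'} {m'' : D.Pro x'' y''}
    {α₁ : D.Cell f₁ g₁ m m'} {α₂ : D.Cell f₂ g₂ m m'}
    {β₁ : D.Cell f₁' g₁' m' m''} {β₂ : D.Cell f₂' g₂' m' m''}
    (hf : f₁ = f₂) (hf' : f₁' = f₂') (hg : g₁ = g₂) (hg' : g₁' = g₂')
    (hα : HEq α₁ α₂) (hβ : HEq β₁ β₂) : HEq (D.vcomp α₁ β₁) (D.vcomp α₂ β₂) := by
  subst hf hf' hg hg'
  rw [eq_of_heq hα, eq_of_heq hβ]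

lemma hcompCell_congr {x x' y y' z z' : D.Obj} {f₁ f₂ : x ⟶ x'} {g₁ g₂ : y ⟶ y'} {h₁ h₂ : z ⟶ z'}
    {m : D.Pro x y} {m' : D.Pro x' y'} {n : D.Pro y z} {n' : D.Pro y' z'}
    {α₁ : D.Cell f₁ g₁ m m'} {α₂ : D.Cell f₂ g₂ m m'}
    {β₁ : D.Cell g₁ h₁ n n'} {β₂ : D.Cell g₂ h₂ n n'}
    (hf : f₁ = f₂) (hg : g₁ = g₂) (hh : h₁ = h₂)
    (hα : HEq α₁ α₂) (hβ : HEq β₁ β₂) : HEq (D.hcompCell α₁ β₁) (D.hcompCell α₂ β₂) := by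
  subst hf hg hh
  rw [eq_of_heq hα, eq_of_heq hβ]

/-- The objects of the category of proarrows and cells of a double category. -/
structure ProObj (D : DblCat.{u, v, p, c}) where
  /-- source of the proarrow -/
  src : D.Obj
  /-- target of the proarrow -/
  tgt : D.Obj
  /-- the proarrow -/
  pro : D.Pro src tgt

/-- The morphisms of the category of proarrows and cells of a double category. -/
structure ProHom {D : DblCat.{u, v, p, c}} (m n : ProObj D) where
  /-- left boundary -/
  left : m.src ⟶ n.src
  /-- right boundary -/
  right : m.tgt ⟶ n.tgt
  /-- the cell -/
  cell : D.Cell left right m.pro n.pro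

/-- A cell as a morphism of the category of proarrows and cells. -/
def toHom {x x' y y' : D.Obj} {f : x ⟶ x'} {g : y ⟶ y'} {m : D.Pro x y} {m' : D.Pro x' y'}
    (α : D.Cell f g m m') : ProHom (D := D) ⟨x, y, m⟩ ⟨x', y', m'⟩ :=
  ⟨f, g, α⟩

lemma toHom_congr {x x' y y' : D.Obj} {f f' : x ⟶ x'} {g g' : y ⟶ y'} {m : D.Pro x y}
    {m' : D.Pro x' y'} {α : D.Cell f g m m'} {β : D.Cell f' g' m m'} (hf : f = f') (hg : g = g')
    (h : HEq α β) : toHom α = toHom β := by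
  subst hf hg
  rw [eq_of_heq h]

lemma heq_of_toHom {x x' y y' : D.Obj} {f f' : x ⟶ x'} {g g' : y ⟶ y'} {m : D.Pro x y}
    {m' : D.Pro x' y'} {α : D.Cell f g m m'} {β : D.Cell f' g' m m'}
    (h : toHom α = toHom β) : HEq α β := by
  simp only [toHom, ProHom.mk.injEq] at h
  exact h.2.2

/-- The category of proarrows and cells of a double category. -/
instance : Category (ProObj D) where
  Hom m n := ProHom m n
  id m := toHom (D.vid m.pro)
  comp α β := toHom (D.vcomp α.cell β.cell)
  id_comp α := toHom_congr (Category.id_comp _) (Category.id_comp _) (D.vid_vcomp α.cell)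
  comp_id α := toHom_congr (Category.comp_id _) (Category.comp_id _) (D.vcomp_vid α.cell)
  assoc α β γ := toHom_congr (Category.assoc _ _ _) (Category.assoc _ _ _)
    (D.vcomp_vcomp α.cell β.cell γ.cell)

/-- A cell as a morphism of the category of proarrows and cells. -/
def hom {x x' y y' : D.Obj} {f : x ⟶ x'} {g : y ⟶ y'} {m : D.Pro x y} {m' : D.Pro x' y'}
    (α : D.Cell f g m m') : (⟨x, y, m⟩ : ProObj D) ⟶ ⟨x', y', m'⟩ :=
  toHom α

lemma heq_of_hom {x x' y y' : D.Obj} {f f' : x ⟶ x'} {g g' : y ⟶ y'} {m : D.Pro x y}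
    {m' : D.Pro x' y'} {α : D.Cell f g m m'} {β : D.Cell f' g' m m'}
    (h : hom α = hom β) : HEq α β :=
  heq_of_toHom h

lemma hom_congr {x x' y y' : D.Obj} {f f' : x ⟶ x'} {g g' : y ⟶ y'} {m : D.Pro x y}
    {m' : D.Pro x' y'} {α : D.Cell f g m m'} {β : D.Cell f' g' m m'} (hf : f = f') (hg : g = g')
    (h : HEq α β) : hom α = hom β :=
  toHom_congr hf hg h

lemma hom_vcomp {x x' x'' y y' y'' : D.Obj} {f : x ⟶ x'} {f' : x' ⟶ x''} {g : y ⟶ y'}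
    {g' : y' ⟶ y''} {m : D.Pro x y} {m' : D.Pro x' y'} {m'' : D.Pro x'' y''}
    (α : D.Cell f g m m') (β : D.Cell f' g' m' m'') :
    hom (D.vcomp α β) = hom α ≫ hom β :=
  rfl

lemma hom_vid {x y : D.Obj} (m : D.Pro x y) : hom (D.vid m) = 𝟙 (⟨x, y, m⟩ : ProObj D) :=
  rfl

lemma hom_castCell {x x' y y' : D.Obj} {f f' : x ⟶ x'} {g g' : y ⟶ y'} {m : D.Pro x y}
    {m' : D.Pro x' y'} (hf : f = f') (hg : g = g') (α : D.Cell f g m m') :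
    hom (castCell hf hg α) = hom α :=
  hom_congr hf.symm hg.symm (castCell_heq hf hg α)

/-- The composite of globular cells (cells whose left and right boundaries are identities). -/
def gcomp {x y : D.Obj} {m n q : D.Pro x y} (α : D.Cell (𝟙 x) (𝟙 y) m n)
    (β : D.Cell (𝟙 x) (𝟙 y) n q) : D.Cell (𝟙 x) (𝟙 y) m q :=
  castCell (Category.comp_id _) (Category.comp_id _) (D.vcomp α β)

lemma hom_gcomp {x y : D.Obj} {m n q : D.Pro x y} (α : D.Cell (𝟙 x) (𝟙 y) m n)
    (β : D.Cell (𝟙 x) (𝟙 y) n q) : hom (gcomp α β) = hom α ≫ hom β :=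
  hom_castCell _ _ _

lemma hom_hcompCell_gcomp_vid {x y z : D.Obj} {m n q : D.Pro x y} (α : D.Cell (𝟙 x) (𝟙 y) m n)
    (β : D.Cell (𝟙 x) (𝟙 y) n q) (r : D.Pro y z) :
    hom (D.hcompCell (gcomp α β) (D.vid r)) =
      hom (D.hcompCell α (D.vid r)) ≫ hom (D.hcompCell β (D.vid r)) := by
  rw [← hom_vcomp, ← D.hcompCell_vcomp]
  exact hom_congr (by simp) (by simp) (hcompCell_congr (by simp) (by simp) (by simp)
    (castCell_heq _ _ _) (D.vid_vcomp _).symm)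

lemma hom_hcompCell_vid_gcomp {x y z : D.Obj} {m n q : D.Pro x y} (α : D.Cell (𝟙 x) (𝟙 y) m n)
    (β : D.Cell (𝟙 x) (𝟙 y) n q) (r : D.Pro z x) :
    hom (D.hcompCell (D.vid r) (gcomp α β)) =
      hom (D.hcompCell (D.vid r) α) ≫ hom (D.hcompCell (D.vid r) β) := by
  rw [← hom_vcomp, ← D.hcompCell_vcomp]
  exact hom_congr (by simp) (by simp) (hcompCell_congr (by simp) (by simp) (by simp)
    (D.vid_vcomp _).symm (castCell_heq _ _ _))

end Cells

end DblCat

/-! ### Colax and pseudo double functors and their transformations -/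

/-- A colax double functor: strictly functorial on arrows and on cells, with comparison cells
`F (m ⊙ n) ⟶ F m ⊙ F n` and `F (id x) ⟶ id (F x)`. -/
structure ColaxFunctor (D : DblCat.{u, v, p, c}) (E : DblCat.{u', v', p', c'}) where
  /-- the underlying functor on objects and arrows -/
  base : D.Obj ⥤ E.Obj
  /-- action on proarrows -/
  pro : ∀ {x y : D.Obj}, D.Pro x y → E.Pro (base.obj x) (base.obj y)
  /-- action on cells -/
  cell : ∀ {x x' y y' : D.Obj} {f : x ⟶ x'} {g : y ⟶ y'} {m : D.Pro x y} {m' : D.Pro x' y'},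
    D.Cell f g m m' → E.Cell (base.map f) (base.map g) (pro m) (pro m')
  /-- comparison cell for composition -/
  compCell : ∀ {x y z : D.Obj} (m : D.Pro x y) (n : D.Pro y z),
    E.Cell (𝟙 (base.obj x)) (𝟙 (base.obj z)) (pro (D.hcomp m n)) (E.hcomp (pro m) (pro n))
  /-- comparison cell for identities -/
  idCell : ∀ x : D.Obj,
    E.Cell (𝟙 (base.obj x)) (𝟙 (base.obj x)) (pro (D.hid x)) (E.hid (base.obj x))
  cell_vid : ∀ {x y : D.Obj} (m : D.Pro x y), HEq (cell (D.vid m)) (E.vid (pro m))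
  cell_vcomp : ∀ {x x' x'' y y' y'' : D.Obj}
    {f : x ⟶ x'} {f' : x' ⟶ x''} {g : y ⟶ y'} {g' : y' ⟶ y''}
    {m : D.Pro x y} {m' : D.Pro x' y'} {m'' : D.Pro x'' y''}
    (α : D.Cell f g m m') (β : D.Cell f' g' m' m''),
    HEq (cell (D.vcomp α β)) (E.vcomp (cell α) (cell β))
  compCell_naturality : ∀ {x x' y y' z z' : D.Obj} {f : x ⟶ x'} {g : y ⟶ y'} {h : z ⟶ z'}
    {m : D.Pro x y} {m' : D.Pro x' y'} {n : D.Pro y z} {n' : D.Pro y' z'}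
    (α : D.Cell f g m m') (β : D.Cell g h n n'),
    HEq (E.vcomp (cell (D.hcompCell α β)) (compCell m' n'))
      (E.vcomp (compCell m n) (E.hcompCell (cell α) (cell β)))
  idCell_naturality : ∀ {x x' : D.Obj} (f : x ⟶ x'),
    HEq (E.vcomp (cell (D.hidCell f)) (idCell x'))
      (E.vcomp (idCell x) (E.hidCell (base.map f)))
  compCell_assoc : ∀ {x y z t : D.Obj} (m : D.Pro x y) (n : D.Pro y z) (q : D.Pro z t),
    HEq (E.vcomp (compCell (D.hcomp m n) q)
        (E.vcomp (E.hcompCell (compCell m n) (E.vid (pro q))) (E.assoc (pro m) (pro n) (pro q))))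
      (E.vcomp (cell (D.assoc m n q))
        (E.vcomp (compCell m (D.hcomp n q)) (E.hcompCell (E.vid (pro m)) (compCell n q))))
  compCell_lunit : ∀ {x y : D.Obj} (m : D.Pro x y),
    HEq (E.vcomp (compCell (D.hid x) m)
        (E.vcomp (E.hcompCell (idCell x) (E.vid (pro m))) (E.lunit (pro m))))
      (cell (D.lunit m))
  compCell_runit : ∀ {x y : D.Obj} (m : D.Pro x y),
    HEq (E.vcomp (compCell m (D.hid y))
        (E.vcomp (E.hcompCell (E.vid (pro m)) (idCell y)) (E.runit (pro m))))
      (cell (D.runit m))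

namespace ColaxFunctor

/-- A colax double functor is a pseudo double functor when its comparison cells are isomorphisms
in the category of proarrows and cells. -/
def IsPseudo {D : DblCat.{u, v, p, c}} {E : DblCat.{u', v', p', c'}} (F : ColaxFunctor D E) :
    Prop :=
  (∀ {x y z : D.Obj} (m : D.Pro x y) (n : D.Pro y z), IsIso (DblCat.hom (F.compCell m n))) ∧
    ∀ x : D.Obj, IsIso (DblCat.hom (F.idCell x))

lemma cell_congr {D : DblCat.{u, v, p, c}} {E : DblCat.{u', v', p', c'}} (F : ColaxFunctor D E)
    {x x' y y' : D.Obj} {f₁ f₂ : x ⟶ x'} {g₁ g₂ : y ⟶ y'} {m : D.Pro x y} {m' : D.Pro x' y'}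
    {α₁ : D.Cell f₁ g₁ m m'} {α₂ : D.Cell f₂ g₂ m m'} (hf : f₁ = f₂) (hg : g₁ = g₂)
    (hα : HEq α₁ α₂) : HEq (F.cell α₁) (F.cell α₂) := by
  subst hf hg
  rw [eq_of_heq hα]


/-- The identity double functor. -/
def id (D : DblCat.{u, v, p, c}) : ColaxFunctor D D where
  base := 𝟭 D.Obj
  pro m := m
  cell α := α
  compCell m n := D.vid (D.hcomp m n)
  idCell x := D.vid (D.hid x)
  cell_vid _ := HEq.rfl
  cell_vcomp _ _ := HEq.rfl
  compCell_naturality α β := (D.vcomp_vid _).trans (D.vid_vcomp _).symm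
  idCell_naturality f := (D.vcomp_vid _).trans (D.vid_vcomp _).symm
  compCell_assoc m n q := by
    apply DblCat.heq_of_hom
    simp only [Functor.id_obj, DblCat.hom_vcomp, D.hcompCell_vid, DblCat.hom_vid,
      Category.id_comp, Category.comp_id]
  compCell_lunit m := by
    apply DblCat.heq_of_hom
    simp only [Functor.id_obj, DblCat.hom_vcomp, D.hcompCell_vid, DblCat.hom_vid,
      Category.id_comp]
  compCell_runit m := by
    apply DblCat.heq_of_hom
    simp only [Functor.id_obj, DblCat.hom_vcomp, D.hcompCell_vid, DblCat.hom_vid,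
      Category.id_comp]

section Comp

variable {D : DblCat.{u, v, p, c}} {E : DblCat.{u', v', p', c'}}

lemma hom_cell_vcomp (F : ColaxFunctor D E) {x x' x'' y y' y'' : D.Obj}
    {f : x ⟶ x'} {f' : x' ⟶ x''} {g : y ⟶ y'} {g' : y' ⟶ y''}
    {m : D.Pro x y} {m' : D.Pro x' y'} {m'' : D.Pro x'' y''}
    (α : D.Cell f g m m') (β : D.Cell f' g' m' m'') :
    DblCat.hom (F.cell (D.vcomp α β)) = DblCat.hom (F.cell α) ≫ DblCat.hom (F.cell β) :=
  DblCat.hom_congr (F.base.map_comp _ _) (F.base.map_comp _ _) (F.cell_vcomp α β)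

/-- The action of a colax double functor on globular cells. -/
def gcell (F : ColaxFunctor D E) {x y : D.Obj} {m n : D.Pro x y}
    (α : D.Cell (𝟙 x) (𝟙 y) m n) :
    E.Cell (𝟙 (F.base.obj x)) (𝟙 (F.base.obj y)) (F.pro m) (F.pro n) :=
  DblCat.castCell (F.base.map_id x) (F.base.map_id y) (F.cell α)

lemma hom_gcell (F : ColaxFunctor D E) {x y : D.Obj} {m n : D.Pro x y}
    (α : D.Cell (𝟙 x) (𝟙 y) m n) : DblCat.hom (F.gcell α) = DblCat.hom (F.cell α) :=
  DblCat.hom_castCell _ _ _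

lemma hom_naturality (F : ColaxFunctor D E) {x x' y y' z z' : D.Obj}
    {f : x ⟶ x'} {g : y ⟶ y'} {h : z ⟶ z'}
    {m : D.Pro x y} {m' : D.Pro x' y'} {n : D.Pro y z} {n' : D.Pro y' z'}
    (α : D.Cell f g m m') (β : D.Cell g h n n') :
    DblCat.hom (F.cell (D.hcompCell α β)) ≫ DblCat.hom (F.compCell m' n') =
      DblCat.hom (F.compCell m n) ≫ DblCat.hom (E.hcompCell (F.cell α) (F.cell β)) :=
  DblCat.hom_congr ((Category.comp_id _).trans (Category.id_comp _).symm)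
    ((Category.comp_id _).trans (Category.id_comp _).symm) (F.compCell_naturality α β)

lemma hom_naturality_left (F : ColaxFunctor D E) {x y z : D.Obj} {m m' : D.Pro x y}
    (α : D.Cell (𝟙 x) (𝟙 y) m m') (n : D.Pro y z) :
    DblCat.hom (F.cell (D.hcompCell α (D.vid n))) ≫ DblCat.hom (F.compCell m' n) =
      DblCat.hom (F.compCell m n) ≫
        DblCat.hom (E.hcompCell (F.gcell α) (E.vid (F.pro n))) := by
  rw [F.hom_naturality]
  congr 1
  exact DblCat.hom_congr (by simp) (by simp) (DblCat.hcompCell_congr (by simp) (by simp) (by simp)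
    (DblCat.castCell_heq _ _ _).symm (F.cell_vid n))

lemma hom_naturality_right (F : ColaxFunctor D E) {x y z : D.Obj} {m m' : D.Pro x y}
    (α : D.Cell (𝟙 x) (𝟙 y) m m') (n : D.Pro z x) :
    DblCat.hom (F.cell (D.hcompCell (D.vid n) α)) ≫ DblCat.hom (F.compCell n m') =
      DblCat.hom (F.compCell n m) ≫
        DblCat.hom (E.hcompCell (E.vid (F.pro n)) (F.gcell α)) := by
  rw [F.hom_naturality]
  congr 1
  exact DblCat.hom_congr (by simp) (by simp) (DblCat.hcompCell_congr (by simp) (by simp) (by simp)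
    (F.cell_vid n) (DblCat.castCell_heq _ _ _).symm)

end Comp

/-- The composite of colax double functors. -/
def comp {D : DblCat.{u, v, p, c}} {E : DblCat.{u', v', p', c'}} {K : DblCat.{u'', v'', p'', c''}}
    (F : ColaxFunctor D E) (G : ColaxFunctor E K) : ColaxFunctor D K where
  base := F.base ⋙ G.base
  pro m := G.pro (F.pro m)
  cell α := G.cell (F.cell α)
  compCell m n := DblCat.gcomp (G.gcell (F.compCell m n)) (G.compCell (F.pro m) (F.pro n))
  idCell x := DblCat.gcomp (G.gcell (F.idCell x)) (G.idCell (F.base.obj x))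
  cell_vid m := (G.cell_congr (by simp) (by simp) (F.cell_vid m)).trans (G.cell_vid _)
  cell_vcomp α β := (G.cell_congr (by simp) (by simp) (F.cell_vcomp α β)).trans (G.cell_vcomp _ _)
  compCell_naturality {x x' y y' z z' f g h m m' n n'} α β := by
    apply DblCat.heq_of_hom
    rw [DblCat.hom_vcomp, DblCat.hom_vcomp]
    erw [DblCat.hom_gcomp, DblCat.hom_gcomp]
    rw [hom_gcell, hom_gcell]
    have h1 := DblCat.hom_congr (by simp) (by simp) (G.cell_congr (by simp) (by simp)
      (F.compCell_naturality α β))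
    rw [G.hom_cell_vcomp, G.hom_cell_vcomp] at h1
    have h2 := G.hom_naturality (F.cell α) (F.cell β)
    erw [reassoc_of% h1, Category.assoc, h2]
  idCell_naturality {x x'} f := by
    apply DblCat.heq_of_hom
    rw [DblCat.hom_vcomp, DblCat.hom_vcomp]
    erw [DblCat.hom_gcomp, DblCat.hom_gcomp]
    rw [hom_gcell, hom_gcell]
    have h1 := DblCat.hom_congr (by simp) (by simp) (G.cell_congr (by simp) (by simp)
      (F.idCell_naturality f))
    rw [G.hom_cell_vcomp, G.hom_cell_vcomp] at h1
    have h2 := DblCat.hom_congr (by simp) (by simp) (G.idCell_naturality (F.base.map f))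
    rw [DblCat.hom_vcomp, DblCat.hom_vcomp] at h2
    erw [reassoc_of% h1, Category.assoc, h2]
    rfl
  compCell_assoc {x y z t} m n q := by
    apply DblCat.heq_of_hom
    have h1 := DblCat.hom_congr (by simp) (by simp) (G.cell_congr (by simp) (by simp)
      (F.compCell_assoc m n q))
    have h2 := DblCat.hom_congr (by simp) (by simp)
      (G.compCell_assoc (F.pro m) (F.pro n) (F.pro q))
    simp only [G.hom_cell_vcomp, DblCat.hom_vcomp] at h1 h2
    have h3 := G.hom_naturality_left (F.compCell m n) (F.pro q)
    have h4 := G.hom_naturality_right (F.compCell n q) (F.pro m)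
    have h5 := DblCat.hom_hcompCell_gcomp_vid (G.gcell (F.compCell m n))
      (G.compCell (F.pro m) (F.pro n)) (G.pro (F.pro q))
    have h6 := DblCat.hom_hcompCell_vid_gcomp (G.gcell (F.compCell n q))
      (G.compCell (F.pro n) (F.pro q)) (G.pro (F.pro m))
    have h7 := DblCat.hom_gcomp (G.gcell (F.compCell (D.hcomp m n) q))
      (G.compCell (F.pro (D.hcomp m n)) (F.pro q))
    have h8 := DblCat.hom_gcomp (G.gcell (F.compCell m (D.hcomp n q)))
      (G.compCell (F.pro m) (F.pro (D.hcomp n q)))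
    rw [hom_gcell] at h7 h8
    simp only [Functor.comp_obj, DblCat.hom_vcomp]
    erw [h5, h6, h7, h8]
    simp only [Category.assoc]
    erw [← reassoc_of% h3, ← reassoc_of% h4, h2, reassoc_of% h1]
  compCell_lunit {x y} m := by
    apply DblCat.heq_of_hom
    have h1 := DblCat.hom_congr (by simp) (by simp) (G.cell_congr (by simp) (by simp)
      (F.compCell_lunit m))
    have h2 := DblCat.hom_congr (by simp) (by simp) (G.compCell_lunit (F.pro m))
    simp only [G.hom_cell_vcomp, DblCat.hom_vcomp] at h1 h2
    have h3 := G.hom_naturality_left (F.idCell x) (F.pro m)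
    have h5 := DblCat.hom_hcompCell_gcomp_vid (G.gcell (F.idCell x))
      (G.idCell (F.base.obj x)) (G.pro (F.pro m))
    have h7 := DblCat.hom_gcomp (G.gcell (F.compCell (D.hid x) m))
      (G.compCell (F.pro (D.hid x)) (F.pro m))
    rw [hom_gcell] at h7
    simp only [Functor.comp_obj, DblCat.hom_vcomp]
    erw [h5, h7]
    simp only [Category.assoc]
    erw [← reassoc_of% h3, h2, h1]
  compCell_runit {x y} m := by
    apply DblCat.heq_of_hom
    have h1 := DblCat.hom_congr (by simp) (by simp) (G.cell_congr (by simp) (by simp)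
      (F.compCell_runit m))
    have h2 := DblCat.hom_congr (by simp) (by simp) (G.compCell_runit (F.pro m))
    simp only [G.hom_cell_vcomp, DblCat.hom_vcomp] at h1 h2
    have h3 := G.hom_naturality_right (F.idCell y) (F.pro m)
    have h5 := DblCat.hom_hcompCell_vid_gcomp (G.gcell (F.idCell y))
      (G.idCell (F.base.obj y)) (G.pro (F.pro m))
    have h7 := DblCat.hom_gcomp (G.gcell (F.compCell m (D.hid y)))
      (G.compCell (F.pro m) (F.pro (D.hid y)))
    rw [hom_gcell] at h7
    simp only [Functor.comp_obj, DblCat.hom_vcomp]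
    erw [h5, h7]
    simp only [Category.assoc]
    erw [← reassoc_of% h3, h2, h1]

end ColaxFunctor

/-- A natural transformation of colax double functors: a natural family of arrows together with a
natural family of cells on proarrows, compatible with the comparison cells. -/
structure ColaxTrans {D : DblCat.{u, v, p, c}} {E : DblCat.{u', v', p', c'}}
    (F G : ColaxFunctor D E) where
  /-- the components at objects -/
  base : F.base ⟶ G.base
  /-- the components at proarrows -/
  cell : ∀ {x y : D.Obj} (m : D.Pro x y),
    E.Cell (base.app x) (base.app y) (F.pro m) (G.pro m)
  cell_naturality : ∀ {x x' y y' : D.Obj} {f : x ⟶ x'} {g : y ⟶ y'}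
    {m : D.Pro x y} {m' : D.Pro x' y'} (α : D.Cell f g m m'),
    HEq (E.vcomp (F.cell α) (cell m')) (E.vcomp (cell m) (G.cell α))
  cell_hcomp : ∀ {x y z : D.Obj} (m : D.Pro x y) (n : D.Pro y z),
    HEq (E.vcomp (F.compCell m n) (E.hcompCell (cell m) (cell n)))
      (E.vcomp (cell (D.hcomp m n)) (G.compCell m n))
  cell_hid : ∀ x : D.Obj,
    HEq (E.vcomp (F.idCell x) (E.hidCell (base.app x))) (E.vcomp (cell (D.hid x)) (G.idCell x))

/-- An adjunction `F ⊣ G` in the 2-category of double categories, colax double functors and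
natural transformations. -/
structure ColaxAdjunction {D : DblCat.{u, v, p, c}} {E : DblCat.{u', v', p', c'}}
    (F : ColaxFunctor D E) (G : ColaxFunctor E D) where
  /-- the unit -/
  unit : ColaxTrans (ColaxFunctor.id D) (F.comp G)
  /-- the counit -/
  counit : ColaxTrans (G.comp F) (ColaxFunctor.id E)
  left_triangle : ∀ x : D.Obj,
    F.base.map (unit.base.app x) ≫ counit.base.app (F.base.obj x) = 𝟙 (F.base.obj x)
  left_triangle_cell : ∀ {x y : D.Obj} (m : D.Pro x y),
    HEq (E.vcomp (F.cell (unit.cell m)) (counit.cell (F.pro m))) (E.vid (F.pro m))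
  right_triangle : ∀ x : E.Obj,
    unit.base.app (G.base.obj x) ≫ G.base.map (counit.base.app x) = 𝟙 (G.base.obj x)
  right_triangle_cell : ∀ {x y : E.Obj} (m : E.Pro x y),
    HEq (D.vcomp (unit.cell (G.pro m)) (G.cell (counit.cell m))) (D.vid (G.pro m))

/-! ### Spans of sets and the double category of families -/

/-- A span of sets `I ← apex → J`. -/
structure SetSpan (I J : Type w) where
  /-- the apex -/
  apex : Type w
  /-- the left leg -/
  l : apex → I
  /-- the right leg -/
  r : apex → J

namespace SetSpan

/-- The elements `a : i ⇸ j` of a span: those elements `a` of the apex lying over `i` and `j`. -/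
def Elt {I J : Type w} (A : SetSpan I J) (i : I) (j : J) : Type w :=
  {a : A.apex // A.l a = i ∧ A.r a = j}

/-- The identity span `I = I = I`. -/
def idSpan (I : Type w) : SetSpan I I where
  apex := I
  l := _root_.id
  r := _root_.id

/-- The elements `i ⇸ j ⇸ k` of the pullback `A ×_J B`: an element `j` of `J` together with
elements of `A` and `B` that lie over it. -/
structure PullbackApex {I J K : Type w} (A : SetSpan I J) (B : SetSpan J K) : Type w where
  /-- the middle element -/
  mid : J
  /-- the first component -/
  fst : A.apex
  /-- the second component -/
  snd : B.apex
  fst_r : A.r fst = mid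
  snd_l : B.l snd = mid

/-- The composite of spans, by pullback. -/
def comp {I J K : Type w} (A : SetSpan I J) (B : SetSpan J K) : SetSpan I K where
  apex := PullbackApex A B
  l e := A.l e.fst
  r e := B.r e.snd

section

variable {I J K : Type w} {A : SetSpan I J} {B : SetSpan J K} {i : I} {k : K}

/-- The first component `i ⇸ j` of an element `i ⇸ j ⇸ k` of a composite span. -/
def Elt.fst (e : (A.comp B).Elt i k) : A.Elt i e.1.mid := ⟨e.1.fst, e.2.1, e.1.fst_r⟩

/-- The second component `j ⇸ k` of an element `i ⇸ j ⇸ k` of a composite span. -/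
def Elt.snd (e : (A.comp B).Elt i k) : B.Elt e.1.mid k := ⟨e.1.snd, e.1.snd_l, e.2.2⟩

end

lemma idSpan_comp_cases {I J : Type w} {A : SetSpan I J}
    {P : ((idSpan I).comp A).apex → Prop} (h : ∀ a, P ⟨A.l a, A.l a, a, rfl, rfl⟩) : ∀ e, P e := by
  rintro ⟨j, i, a, h₁, h₂⟩
  change i = j at h₁
  subst h₁ h₂
  exact h a

lemma comp_idSpan_cases {I J : Type w} {A : SetSpan I J}
    {P : (A.comp (idSpan J)).apex → Prop} (h : ∀ a, P ⟨A.r a, a, A.r a, rfl, rfl⟩) : ∀ e, P e := by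
  rintro ⟨i, a, j, h₁, h₂⟩
  change j = i at h₂
  subst h₂ h₁
  exact h a

lemma comp_idSpan_comp_cases {I J K : Type w} {A : SetSpan I J} {B : SetSpan J K}
    {P : ((A.comp (idSpan J)).comp B).apex → Prop}
    (h : ∀ (a) (b) (h : B.l b = A.r a), P ⟨A.r a, ⟨A.r a, a, A.r a, rfl, rfl⟩, b, rfl, h⟩) :
    ∀ e, P e := by
  rintro ⟨j, e, b, h₁, h₂⟩
  revert h₁
  refine comp_idSpan_cases (P := fun e => ∀ h₁, P ⟨j, e, b, h₁, h₂⟩) (fun a h₁ => ?_) e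
  change A.r a = j at h₁
  subst h₁
  exact h a b h₂

/-- A map of spans over given functions between the feet. -/
structure Map {I J I' J' : Type w} (f : I → I') (g : J → J') (A : SetSpan I J)
    (B : SetSpan I' J') where
  /-- the function between the apexes -/
  map : A.apex → B.apex
  map_l : ∀ a, B.l (map a) = f (A.l a)
  map_r : ∀ a, B.r (map a) = g (A.r a)

/-- A map of spans sends elements `i ⇸ j` to elements `f i ⇸ g j`. -/
def Map.elt {I J I' J' : Type w} {f : I → I'} {g : J → J'} {A : SetSpan I J}
    {B : SetSpan I' J'} (φ : Map f g A B) {i : I} {j : J} (a : A.Elt i j) : B.Elt (f i) (g j) :=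
  ⟨φ.map a.1, (φ.map_l a.1).trans (congrArg f a.2.1), (φ.map_r a.1).trans (congrArg g a.2.2)⟩

end SetSpan

/-- An indexed family of objects. -/
structure FamObj (D : DblCat.{u, v, p, c}) where
  /-- the indexing set -/
  I : Type w
  /-- the members of the family -/
  obj : I → D.Obj

/-- An arrow of families. -/
structure FamHom {D : DblCat.{u, v, p, c}} (X Y : FamObj.{w} D) where
  /-- the function between the indexing sets -/
  ind : X.I → Y.I
  /-- the family of arrows -/
  arr : ∀ i, X.obj i ⟶ Y.obj (ind i)

instance famCategory (D : DblCat.{u, v, p, c}) : Category (FamObj.{w} D) where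
  Hom X Y := FamHom X Y
  id X := ⟨fun i => i, fun i => 𝟙 (X.obj i)⟩
  comp f g := ⟨fun i => g.ind (f.ind i), fun i => f.arr i ≫ g.arr (f.ind i)⟩
  id_comp f := by simp
  comp_id f := by simp
  assoc f g h := by simp

/-- A proarrow of families: an indexing span together with proarrows `m_a : x_i ⇸ y_j` for each
element `a : i ⇸ j` of the span. -/
structure FamPro {D : DblCat.{u, v, p, c}} (X Y : FamObj.{w} D) where
  /-- the indexing span -/
  span : SetSpan X.I Y.I
  /-- the members of the family -/
  pro : ∀ {i : X.I} {j : Y.I}, span.Elt i j → D.Pro (X.obj i) (Y.obj j)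

/-- A cell of families: a map of indexing spans together with cells in `D` with boundary
`f_i, g_j, m_a, n_{α₀ a}` for each element `a : i ⇸ j` of the indexing span of the top. -/
structure FamCell {D : DblCat.{u, v, p, c}} {X X' Y Y' : FamObj.{w} D} (f : X ⟶ X') (g : Y ⟶ Y')
    (M : FamPro X Y) (N : FamPro X' Y') where
  /-- the map of indexing spans -/
  ind : SetSpan.Map f.ind g.ind M.span N.span
  /-- the family of cells -/
  cell : ∀ {i : X.I} {j : Y.I} (a : M.span.Elt i j),
    D.Cell (f.arr i) (g.arr j) (M.pro a) (N.pro (ind.elt a))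

namespace DblFam

variable {D : DblCat.{u, v, p, c}}

lemma cell_heq {X X' Y Y' : FamObj.{w} D} {f f' : X ⟶ X'} {g g' : Y ⟶ Y'}
    {M : FamPro X Y} {N : FamPro X' Y'} {α : FamCell f g M N} {β : FamCell f' g' M N}
    (hf : f = f') (hg : g = g') (h₀ : ∀ a, α.ind.map a = β.ind.map a)
    (h : ∀ a : M.span.apex, HEq (α.cell ⟨a, rfl, rfl⟩) (β.cell ⟨a, rfl, rfl⟩)) : HEq α β := by
  subst hf hg
  obtain ⟨⟨α₀, hαl, hαr⟩, α⟩ := α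
  obtain ⟨⟨β₀, hβl, hβr⟩, β⟩ := β
  obtain rfl : α₀ = β₀ := funext h₀
  apply heq_of_eq
  congr 1
  funext i j ⟨a, hi, hj⟩
  subst hi hj
  exact eq_of_heq (h a)

/-- The identity proarrow of `D`, between equal members of a family. -/
def idPro (X : FamObj.{w} D) {i j : X.I} (h : i = j) : D.Pro (X.obj i) (X.obj j) :=
  h ▸ D.hid (X.obj i)

/-- The identity cell on a member of a family of arrows. -/
def hidCellAux {X Y : FamObj.{w} D} (f : X ⟶ Y) {i j : X.I} (h : i = j)
    (h' : f.ind i = f.ind j) : D.Cell (f.arr i) (f.arr j) (idPro X h) (idPro Y h') := by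
  subst h
  exact D.hidCell (f.arr i)

/-- The identity proarrow on a family, indexed by the identity span. -/
def hid (X : FamObj.{w} D) : FamPro X X where
  span := SetSpan.idSpan X.I
  pro a := idPro X (a.2.1.symm.trans a.2.2)

/-- The composite of families of proarrows. -/
def hcomp {X Y Z : FamObj.{w} D} (M : FamPro X Y) (N : FamPro Y Z) : FamPro X Z where
  span := M.span.comp N.span
  pro a := D.hcomp (M.pro a.fst) (N.pro a.snd)

/-- The left unitor of a member of a family of proarrows. -/
def lunitAux {X Y : FamObj.{w} D} (M : FamPro X Y) {i j : X.I} {k : Y.I} (h : i = j)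
    (a : M.span.Elt j k) (a' : M.span.Elt i k) (ha : a'.1 = a.1) :
    D.Cell (𝟙 (X.obj i)) (𝟙 (Y.obj k)) (D.hcomp (idPro X h) (M.pro a)) (M.pro a') := by
  subst h
  obtain rfl : a' = a := Subtype.ext ha
  exact D.lunit _

/-- The inverse left unitor of a member of a family of proarrows. -/
def lunitInvAux {X Y : FamObj.{w} D} (M : FamPro X Y) {i j : X.I} {k : Y.I} (h : i = j)
    (a : M.span.Elt j k) (a' : M.span.Elt i k) (ha : a'.1 = a.1) :
    D.Cell (𝟙 (X.obj i)) (𝟙 (Y.obj k)) (M.pro a') (D.hcomp (idPro X h) (M.pro a)) := by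
  subst h
  obtain rfl : a' = a := Subtype.ext ha
  exact D.lunitInv _

/-- The right unitor of a member of a family of proarrows. -/
def runitAux {X Y : FamObj.{w} D} (M : FamPro X Y) {i : X.I} {j k : Y.I} (h : j = k)
    (a : M.span.Elt i j) (a' : M.span.Elt i k) (ha : a'.1 = a.1) :
    D.Cell (𝟙 (X.obj i)) (𝟙 (Y.obj k)) (D.hcomp (M.pro a) (idPro Y h)) (M.pro a') := by
  subst h
  obtain rfl : a' = a := Subtype.ext ha
  exact D.runit _

/-- The inverse right unitor of a member of a family of proarrows. -/
def runitInvAux {X Y : FamObj.{w} D} (M : FamPro X Y) {i : X.I} {j k : Y.I} (h : j = k)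
    (a : M.span.Elt i j) (a' : M.span.Elt i k) (ha : a'.1 = a.1) :
    D.Cell (𝟙 (X.obj i)) (𝟙 (Y.obj k)) (M.pro a') (D.hcomp (M.pro a) (idPro Y h)) := by
  subst h
  obtain rfl : a' = a := Subtype.ext ha
  exact D.runitInv _

end DblFam

open SetSpan in
/-- The double category of (set-indexed) families in a double category. -/
def DblFam (D : DblCat.{u, v, p, c}) :
    DblCat.{max u (w + 1), max v w, max p (w + 1), max c w} where
  Obj := FamObj.{w} D
  Pro X Y := FamPro X Y
  Cell f g M N := FamCell f g M N
  vid M := ⟨⟨fun a => a, fun _ => rfl, fun _ => rfl⟩, fun a => D.vid (M.pro a)⟩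
  vcomp {_ _ _ _ _ _ f f' g g' _ _ _} α β :=
    ⟨⟨fun a => β.ind.map (α.ind.map a),
        fun a => (β.ind.map_l _).trans (congrArg f'.ind (α.ind.map_l a)),
        fun a => (β.ind.map_r _).trans (congrArg g'.ind (α.ind.map_r a))⟩,
      fun a => D.vcomp (α.cell a) (β.cell (α.ind.elt a))⟩
  hid X := DblFam.hid X
  hcomp M N := DblFam.hcomp M N
  hidCell f := ⟨⟨f.ind, fun _ => rfl, fun _ => rfl⟩, fun a => DblFam.hidCellAux f _ _⟩
  hcompCell {_ _ _ _ _ _ f g h _ _ _ _} α β :=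
    ⟨⟨fun e => ⟨g.ind e.mid, α.ind.map e.fst, β.ind.map e.snd,
          (α.ind.map_r _).trans (congrArg g.ind e.fst_r),
          (β.ind.map_l _).trans (congrArg g.ind e.snd_l)⟩,
        fun e => α.ind.map_l e.fst, fun e => β.ind.map_r e.snd⟩,
      fun e => D.hcompCell (α.cell e.fst) (β.cell e.snd)⟩
  assoc M N Q :=
    ⟨⟨fun e => ⟨e.fst.mid, e.fst.fst, ⟨e.mid, e.fst.snd, e.snd, e.fst_r, e.snd_l⟩,
          e.fst.fst_r, e.fst.snd_l⟩, fun _ => rfl, fun _ => rfl⟩,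
      fun e => D.assoc (M.pro e.fst.fst) (N.pro e.fst.snd) (Q.pro e.snd)⟩
  assocInv M N Q :=
    ⟨⟨fun e => ⟨e.snd.mid, ⟨e.mid, e.fst, e.snd.fst, e.fst_r, e.snd_l⟩, e.snd.snd,
          e.snd.fst_r, e.snd.snd_l⟩, fun _ => rfl, fun _ => rfl⟩,
      fun e => D.assocInv (M.pro e.fst) (N.pro e.snd.fst) (Q.pro e.snd.snd)⟩
  lunit M :=
    ⟨⟨fun e => e.snd, fun e => e.snd_l.trans e.fst_r.symm, fun _ => rfl⟩,
      fun e => DblFam.lunitAux M _ e.snd _ rfl⟩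
  lunitInv M :=
    ⟨⟨fun a => ⟨M.span.l a, M.span.l a, a, rfl, rfl⟩, fun _ => rfl, fun _ => rfl⟩,
      fun a => DblFam.lunitInvAux M a.2.1.symm _ _ rfl⟩
  runit M :=
    ⟨⟨fun e => e.fst, fun _ => rfl, fun e => e.fst_r.trans e.snd_l.symm⟩,
      fun e => DblFam.runitAux M _ e.fst _ rfl⟩
  runitInv M :=
    ⟨⟨fun a => ⟨M.span.r a, a, M.span.r a, rfl, rfl⟩, fun _ => rfl, fun _ => rfl⟩,
      fun a => DblFam.runitInvAux M a.2.2 _ _ rfl⟩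
  vid_vcomp α := DblFam.cell_heq (Category.id_comp _) (Category.id_comp _) (fun _ => rfl)
    fun _ => D.vid_vcomp _
  vcomp_vid α := DblFam.cell_heq (Category.comp_id _) (Category.comp_id _) (fun _ => rfl)
    fun _ => D.vcomp_vid _
  vcomp_vcomp α β γ := DblFam.cell_heq (Category.assoc _ _ _) (Category.assoc _ _ _)
    (fun _ => rfl) fun _ => D.vcomp_vcomp _ _ _
  hcompCell_vid M N := eq_of_heq <| DblFam.cell_heq rfl rfl (fun _ => rfl)
    fun _ => heq_of_eq (D.hcompCell_vid _ _)
  hcompCell_vcomp α α' β β' := eq_of_heq <| DblFam.cell_heq rfl rfl (fun _ => rfl)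
    fun _ => heq_of_eq (D.hcompCell_vcomp _ _ _ _)
  hidCell_id X := eq_of_heq <| DblFam.cell_heq rfl rfl (fun _ => rfl)
    fun _ => heq_of_eq (D.hidCell_id _)
  hidCell_comp f g := eq_of_heq <| DblFam.cell_heq rfl rfl (fun _ => rfl)
    fun _ => heq_of_eq (D.hidCell_comp _ _)
  assoc_assocInv M N Q := DblFam.cell_heq (Category.comp_id _) (Category.comp_id _) (fun _ => rfl)
    fun _ => D.assoc_assocInv _ _ _
  assocInv_assoc M N Q := DblFam.cell_heq (Category.comp_id _) (Category.comp_id _) (fun _ => rfl)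
    fun _ => D.assocInv_assoc _ _ _
  lunit_lunitInv M := DblFam.cell_heq (Category.comp_id _) (Category.comp_id _)
    (SetSpan.idSpan_comp_cases fun _ => rfl)
    (SetSpan.idSpan_comp_cases fun _ => D.lunit_lunitInv _)
  lunitInv_lunit M := DblFam.cell_heq (Category.comp_id _) (Category.comp_id _) (fun _ => rfl)
    fun _ => D.lunitInv_lunit _
  runit_runitInv M := DblFam.cell_heq (Category.comp_id _) (Category.comp_id _)
    (SetSpan.comp_idSpan_cases fun _ => rfl)
    (SetSpan.comp_idSpan_cases fun _ => D.runit_runitInv _)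
  runitInv_runit M := DblFam.cell_heq (Category.comp_id _) (Category.comp_id _) (fun _ => rfl)
    fun _ => D.runitInv_runit _
  assoc_naturality α β γ := DblFam.cell_heq
    ((Category.comp_id _).trans (Category.id_comp _).symm)
    ((Category.comp_id _).trans (Category.id_comp _).symm) (fun _ => rfl)
    fun _ => D.assoc_naturality _ _ _
  lunit_naturality α := DblFam.cell_heq
    ((Category.comp_id _).trans (Category.id_comp _).symm)
    ((Category.comp_id _).trans (Category.id_comp _).symm) (fun _ => rfl)
    (SetSpan.idSpan_comp_cases fun a => D.lunit_naturality (α.cell ⟨a, rfl, rfl⟩))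
  runit_naturality α := DblFam.cell_heq
    ((Category.comp_id _).trans (Category.id_comp _).symm)
    ((Category.comp_id _).trans (Category.id_comp _).symm) (fun _ => rfl)
    (SetSpan.comp_idSpan_cases fun a => D.runit_naturality (α.cell ⟨a, rfl, rfl⟩))
  pentagon M N Q R := DblFam.cell_heq (by simp) (by simp) (fun _ => rfl)
    fun _ => D.pentagon _ _ _ _
  triangle M N := DblFam.cell_heq (by simp) (by simp)
    (SetSpan.comp_idSpan_comp_cases fun _ _ _ => rfl)
    (SetSpan.comp_idSpan_comp_cases fun _ _ _ => D.triangle _ _)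

/-- The functor sending objects and arrows to singleton families. -/
def DblFam.singletonBase (D : DblCat.{u, v, p, c}) : D.Obj ⥤ FamObj.{w} D where
  obj x := ⟨PUnit, fun _ => x⟩
  map f := ⟨fun i => i, fun _ => f⟩

/-- The double functor `D ⥤ DblFam D` sending objects and proarrows to singleton families. -/
def DblFam.singleton (D : DblCat.{u, v, p, c}) : ColaxFunctor D (DblFam.{w} D) where
  base := DblFam.singletonBase D
  pro m := ⟨⟨PUnit, fun a => a, fun a => a⟩, fun _ => m⟩
  cell α := ⟨⟨fun a => a, fun _ => rfl, fun _ => rfl⟩, fun _ => α⟩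
  compCell m n :=
    ⟨⟨fun a => ⟨a, a, a, rfl, rfl⟩, fun _ => rfl, fun _ => rfl⟩, fun _ => D.vid (D.hcomp m n)⟩
  idCell x := ⟨⟨fun a => a, fun _ => rfl, fun _ => rfl⟩, fun _ => D.vid (D.hid x)⟩
  cell_vid m := HEq.rfl
  cell_vcomp α β := HEq.rfl
  compCell_naturality α β := DblFam.cell_heq
    ((Category.comp_id _).trans (Category.id_comp _).symm)
    ((Category.comp_id _).trans (Category.id_comp _).symm) (fun _ => rfl)
    fun _ => (D.vcomp_vid _).trans (D.vid_vcomp _).symm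
  idCell_naturality f := DblFam.cell_heq
    ((Category.comp_id _).trans (Category.id_comp _).symm)
    ((Category.comp_id _).trans (Category.id_comp _).symm) (fun _ => rfl)
    fun _ => (D.vcomp_vid _).trans (D.vid_vcomp _).symm
  compCell_assoc m n q := DblFam.cell_heq rfl rfl (fun _ => rfl)
    fun _ => (ColaxFunctor.id D).compCell_assoc m n q
  compCell_lunit m := DblFam.cell_heq (by simp; rfl) (by simp; rfl) (fun _ => rfl)
    fun _ => (ColaxFunctor.id D).compCell_lunit m
  compCell_runit m := DblFam.cell_heq (by simp; rfl) (by simp; rfl) (fun _ => rfl)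
    fun _ => (ColaxFunctor.id D).compCell_runit m

/-- A double category has strong coproducts if `D ⥤ DblFam D` has a colax left adjoint that is a
pseudo double functor. -/
def DblCat.HasStrongCoproducts (D : DblCat.{u, v, p, c}) : Prop :=
  ∃ S : ColaxFunctor (DblFam.{w} D) D,
    S.IsPseudo ∧ Nonempty (ColaxAdjunction S (DblFam.singleton.{w} D))

section Coprojections

variable {D : DblCat.{u, v, p, c}} {S : ColaxFunctor (DblFam.{w} D) D}
  (adj : ColaxAdjunction S (DblFam.singleton.{w} D))

/-- The coprojection `x_i ⟶ Σ x` of a family of objects: a component of the unit. -/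
def ColaxAdjunction.objCoproj (X : FamObj.{w} D) (i : X.I) :
    X.obj i ⟶ S.base.obj X :=
  FamHom.arr (adj.unit.base.app X) i

/-- The coprojection of a family of proarrows at `a : i ⇸ j`, a cell from `m_a : x_i ⇸ y_j` to
`Σ m : Σ x ⇸ Σ y` bounded by coprojections of objects: a component of the unit. -/
def ColaxAdjunction.proCoproj {X Y : FamObj.{w} D} (M : FamPro X Y) {i : X.I} {j : Y.I}
    (a : M.span.Elt i j) :
    D.Cell (adj.objCoproj X i) (adj.objCoproj Y j) (M.pro a) (S.pro M) :=
  FamCell.cell (adj.unit.cell M) a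

end Coprojections

/-! ### The double category of matrices -/

/-- The tensor product distributes over coproducts (indexed by sets in `Type w`), separately in
each variable.  A distributive monoidal category is a symmetric monoidal category with this
property. -/
class DistributiveMonoidal (V : Type u) [Category.{v} V] [MonoidalCategory V] : Prop where
  hasCoproducts : HasCoproducts.{w} V
  preservesLeft : ∀ (A : V) (J : Type w), PreservesColimitsOfShape (Discrete J) (tensorLeft A)
  preservesRight : ∀ (A : V) (J : Type w), PreservesColimitsOfShape (Discrete J) (tensorRight A)

attribute [instance] DistributiveMonoidal.hasCoproducts DistributiveMonoidal.preservesLeft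
  DistributiveMonoidal.preservesRight

namespace VMat

variable {V : Type u} [Category.{v} V] [MonoidalCategory V] [DistributiveMonoidal.{w} V]

section Sum

variable {J : Type w} (A : J → V) (B : V) {Z : V}

/-- A morphism out of `(∐ A) ⊗ B`. -/
noncomputable def sumDescR (φ : ∀ j, A j ⊗ B ⟶ Z) : (∐ A) ⊗ B ⟶ Z :=
  Cofan.IsColimit.desc (isColimitOfHasCoproductOfPreservesColimit (tensorRight B) A) φ

lemma ι_sumDescR (φ : ∀ j, A j ⊗ B ⟶ Z) (j : J) : Sigma.ι A j ▷ B ≫ sumDescR A B φ = φ j :=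
  Cofan.IsColimit.fac (isColimitOfHasCoproductOfPreservesColimit (tensorRight B) A) φ j

lemma sumR_ext {f g : (∐ A) ⊗ B ⟶ Z} (h : ∀ j, Sigma.ι A j ▷ B ≫ f = Sigma.ι A j ▷ B ≫ g) :
    f = g :=
  Cofan.IsColimit.hom_ext (isColimitOfHasCoproductOfPreservesColimit (tensorRight B) A) _ _ h

/-- A morphism out of `B ⊗ (∐ A)`. -/
noncomputable def sumDescL (φ : ∀ j, B ⊗ A j ⟶ Z) : B ⊗ (∐ A) ⟶ Z :=
  Cofan.IsColimit.desc (isColimitOfHasCoproductOfPreservesColimit (tensorLeft B) A) φ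

lemma ι_sumDescL (φ : ∀ j, B ⊗ A j ⟶ Z) (j : J) : B ◁ Sigma.ι A j ≫ sumDescL A B φ = φ j :=
  Cofan.IsColimit.fac (isColimitOfHasCoproductOfPreservesColimit (tensorLeft B) A) φ j

lemma sumL_ext {f g : B ⊗ (∐ A) ⟶ Z} (h : ∀ j, B ◁ Sigma.ι A j ≫ f = B ◁ Sigma.ι A j ≫ g) :
    f = g :=
  Cofan.IsColimit.hom_ext (isColimitOfHasCoproductOfPreservesColimit (tensorLeft B) A) _ _ h

end Sum

variable {X Y Z W T : Type w}

/-- The product of matrices, `(M ⊙ N)(x, z) = ∐_y M(x, y) ⊗ N(y, z)`. -/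
noncomputable def hcomp (M : X → Y → V) (N : Y → Z → V) (x : X) (z : Z) : V :=
  ∐ fun y => M x y ⊗ N y z

/-- The identity matrix.  The entry at `(x, x')` is the coproduct of copies of the monoidal unit
indexed by the proofs of `x = x'`: it is the unit if `x = x'` and initial otherwise. -/
noncomputable def hid (X : Type w) (x x' : X) : V :=
  ∐ fun _ : ULift.{w} (PLift (x = x')) => 𝟙_ V

/-- The coprojections of a product of matrices. -/
noncomputable def inj (M : X → Y → V) (N : Y → Z → V) (x : X) (y : Y) (z : Z) :
    M x y ⊗ N y z ⟶ hcomp M N x z :=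
  Sigma.ι (fun y => M x y ⊗ N y z) y

/-- The coprojection of an identity matrix. -/
noncomputable def unitInj {x x' : X} (h : x = x') : 𝟙_ V ⟶ hid X x x' :=
  Sigma.ι (fun _ : ULift.{w} (PLift (x = x')) => 𝟙_ V) ⟨⟨h⟩⟩

section

variable {M : X → Y → V} {N : Y → Z → V} {x : X} {z : Z} {A B C : V}

/-- Morphisms out of a product of matrices. -/
noncomputable def desc (φ : ∀ y, M x y ⊗ N y z ⟶ A) : hcomp M N x z ⟶ A := Sigma.desc φ

lemma inj_desc (φ : ∀ y, M x y ⊗ N y z ⟶ A) (y : Y) : inj M N x y z ≫ desc φ = φ y :=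
  Sigma.ι_desc φ y

lemma inj_desc_assoc (φ : ∀ y, M x y ⊗ N y z ⟶ A) (y : Y) (h : A ⟶ B) :
    inj M N x y z ≫ desc φ ≫ h = φ y ≫ h := by
  rw [← Category.assoc, inj_desc]

lemma hcomp_ext {f g : hcomp M N x z ⟶ A} (h : ∀ y, inj M N x y z ≫ f = inj M N x y z ≫ g) :
    f = g :=
  Sigma.hom_ext _ _ h

/-- Morphisms out of a tensor product with a product of matrices. -/
noncomputable def descR (φ : ∀ y, (M x y ⊗ N y z) ⊗ B ⟶ A) : hcomp M N x z ⊗ B ⟶ A :=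
  sumDescR _ B φ

lemma inj_descR (φ : ∀ y, (M x y ⊗ N y z) ⊗ B ⟶ A) (y : Y) :
    inj M N x y z ▷ B ≫ descR φ = φ y :=
  ι_sumDescR _ B φ y

lemma inj_descR_assoc (φ : ∀ y, (M x y ⊗ N y z) ⊗ B ⟶ A) (y : Y) (h : A ⟶ C) :
    inj M N x y z ▷ B ≫ descR φ ≫ h = φ y ≫ h := by
  rw [← Category.assoc, inj_descR]

lemma hcompR_ext {f g : hcomp M N x z ⊗ B ⟶ A}
    (h : ∀ y, inj M N x y z ▷ B ≫ f = inj M N x y z ▷ B ≫ g) : f = g :=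
  sumR_ext _ B h

/-- Morphisms out of a tensor product with a product of matrices. -/
noncomputable def descL (φ : ∀ y, B ⊗ (M x y ⊗ N y z) ⟶ A) : B ⊗ hcomp M N x z ⟶ A :=
  sumDescL _ B φ

lemma inj_descL (φ : ∀ y, B ⊗ (M x y ⊗ N y z) ⟶ A) (y : Y) :
    B ◁ inj M N x y z ≫ descL φ = φ y :=
  ι_sumDescL _ B φ y

lemma inj_descL_assoc (φ : ∀ y, B ⊗ (M x y ⊗ N y z) ⟶ A) (y : Y) (h : A ⟶ C) :
    B ◁ inj M N x y z ≫ descL φ ≫ h = φ y ≫ h := by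
  rw [← Category.assoc, inj_descL]

lemma hcompL_ext {f g : B ⊗ hcomp M N x z ⟶ A}
    (h : ∀ y, B ◁ inj M N x y z ≫ f = B ◁ inj M N x y z ≫ g) : f = g :=
  sumL_ext _ B h

lemma hcompRR_ext {f g : (hcomp M N x z ⊗ B) ⊗ C ⟶ A}
    (h : ∀ y, inj M N x y z ▷ B ▷ C ≫ f = inj M N x y z ▷ B ▷ C ≫ g) : f = g := by
  rw [← cancel_epi (α_ _ _ _).inv]
  apply hcompR_ext
  intro y
  rw [associator_inv_naturality_left_assoc, associator_inv_naturality_left_assoc, h]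

end

section

variable {x x' : X} {A B C : V}

/-- Morphisms out of an entry of an identity matrix. -/
noncomputable def unitDesc (φ : x = x' → (𝟙_ V ⟶ A)) : hid X x x' ⟶ A :=
  Sigma.desc fun h => φ h.down.down

lemma unitInj_desc (φ : x = x' → (𝟙_ V ⟶ A)) (h : x = x') : unitInj h ≫ unitDesc φ = φ h :=
  Sigma.ι_desc _ _

lemma unitInj_desc_assoc (φ : x = x' → (𝟙_ V ⟶ A)) (h : x = x') (f : A ⟶ B) :
    unitInj h ≫ unitDesc φ ≫ f = φ h ≫ f := by
  rw [← Category.assoc, unitInj_desc]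

lemma unit_ext {f g : hid X x x' ⟶ A} (h : ∀ e : x = x', unitInj e ≫ f = unitInj e ≫ g) :
    f = g :=
  Sigma.hom_ext _ _ fun e => h e.down.down

/-- Morphisms out of a tensor product with an entry of an identity matrix. -/
noncomputable def unitDescR (φ : x = x' → (𝟙_ V ⊗ B ⟶ A)) : hid X x x' ⊗ B ⟶ A :=
  sumDescR _ B fun h => φ h.down.down

lemma unitInj_descR (φ : x = x' → (𝟙_ V ⊗ B ⟶ A)) (h : x = x') :
    unitInj h ▷ B ≫ unitDescR φ = φ h :=
  ι_sumDescR _ B _ _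

lemma unitInj_descR_assoc (φ : x = x' → (𝟙_ V ⊗ B ⟶ A)) (h : x = x') (f : A ⟶ C) :
    unitInj h ▷ B ≫ unitDescR φ ≫ f = φ h ≫ f := by
  rw [← Category.assoc, unitInj_descR]

lemma unitR_ext {f g : hid X x x' ⊗ B ⟶ A}
    (h : ∀ e : x = x', unitInj e ▷ B ≫ f = unitInj e ▷ B ≫ g) : f = g :=
  sumR_ext _ B fun e => h e.down.down

/-- Morphisms out of a tensor product with an entry of an identity matrix. -/
noncomputable def unitDescL (φ : x = x' → (B ⊗ 𝟙_ V ⟶ A)) : B ⊗ hid X x x' ⟶ A :=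
  sumDescL _ B fun h => φ h.down.down

lemma unitInj_descL (φ : x = x' → (B ⊗ 𝟙_ V ⟶ A)) (h : x = x') :
    B ◁ unitInj h ≫ unitDescL φ = φ h :=
  ι_sumDescL _ B _ _

lemma unitInj_descL_assoc (φ : x = x' → (B ⊗ 𝟙_ V ⟶ A)) (h : x = x') (f : A ⟶ C) :
    B ◁ unitInj h ≫ unitDescL φ ≫ f = φ h ≫ f := by
  rw [← Category.assoc, unitInj_descL]

lemma unitL_ext {f g : B ⊗ hid X x x' ⟶ A}
    (h : ∀ e : x = x', B ◁ unitInj e ≫ f = B ◁ unitInj e ≫ g) : f = g :=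
  sumL_ext _ B fun e => h e.down.down

lemma unitLR_ext {f g : (B ⊗ hid X x x') ⊗ C ⟶ A}
    (h : ∀ e : x = x', (B ◁ unitInj e) ▷ C ≫ f = (B ◁ unitInj e) ▷ C ≫ g) : f = g :=
  Cofan.IsColimit.hom_ext (isColimitOfHasCoproductOfPreservesColimit
    (tensorLeft B ⋙ tensorRight C) (fun _ : ULift.{w} (PLift (x = x')) => 𝟙_ V)) _ _
    fun e => h e.down.down

end

section

variable {X' Y' Z' : Type w}

/-- A cell of matrices with left and right boundaries `f` and `g`. -/
abbrev Cell (f : X → X') (g : Y → Y') (M : X → Y → V) (N : X' → Y' → V) : Type (max w v) :=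
  ∀ x y, M x y ⟶ N (f x) (g y)

/-- External identity cells. -/
noncomputable def hidCell (f : X → X') : Cell f f (hid (V := V) X) (hid X') :=
  fun _ _ => unitDesc fun h => unitInj (congrArg f h)

/-- External composition of cells. -/
noncomputable def hcompCell {f : X → X'} {g : Y → Y'} {h : Z → Z'} {M : X → Y → V}
    {M' : X' → Y' → V} {N : Y → Z → V} {N' : Y' → Z' → V}
    (α : Cell f g M M') (β : Cell g h N N') : Cell f h (hcomp M N) (hcomp M' N') :=
  fun x z => desc fun y => (α x y ⊗ₘ β y z) ≫ inj M' N' (f x) (g y) (h z)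

lemma inj_hcompCell {f : X → X'} {g : Y → Y'} {h : Z → Z'} {M : X → Y → V}
    {M' : X' → Y' → V} {N : Y → Z → V} {N' : Y' → Z' → V}
    (α : Cell f g M M') (β : Cell g h N N') (x : X) (y : Y) (z : Z) :
    inj M N x y z ≫ hcompCell α β x z = (α x y ⊗ₘ β y z) ≫ inj M' N' (f x) (g y) (h z) :=
  inj_desc _ _

lemma inj_hcompCell_assoc {f : X → X'} {g : Y → Y'} {h : Z → Z'} {M : X → Y → V}
    {M' : X' → Y' → V} {N : Y → Z → V} {N' : Y' → Z' → V}
    (α : Cell f g M M') (β : Cell g h N N') (x : X) (y : Y) (z : Z) {A : V}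
    (k : hcomp M' N' (f x) (h z) ⟶ A) :
    inj M N x y z ≫ hcompCell α β x z ≫ k =
      (α x y ⊗ₘ β y z) ≫ inj M' N' (f x) (g y) (h z) ≫ k := by
  rw [← Category.assoc, inj_hcompCell, Category.assoc]

lemma unitInj_hidCell (f : X → X') {x x' : X} (e : x = x') :
    unitInj (V := V) e ≫ hidCell f x x' = unitInj (congrArg f e) :=
  unitInj_desc _ _

/-- Associator. -/
noncomputable def assoc (M : X → Y → V) (N : Y → Z → V) (Q : Z → W → V) (x : X) (t : W) :
    hcomp (hcomp M N) Q x t ⟶ hcomp M (hcomp N Q) x t :=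
  desc fun z => descR fun y => (α_ _ _ _).hom ≫ M x y ◁ inj N Q y z t ≫ inj M (hcomp N Q) x y t

/-- Inverse associator. -/
noncomputable def assocInv (M : X → Y → V) (N : Y → Z → V) (Q : Z → W → V) (x : X) (t : W) :
    hcomp M (hcomp N Q) x t ⟶ hcomp (hcomp M N) Q x t :=
  desc fun y => descL fun z => (α_ _ _ _).inv ≫ inj M N x y z ▷ Q z t ≫ inj (hcomp M N) Q x z t

/-- Left unitor. -/
noncomputable def lunit (M : X → Y → V) (x : X) (y : Y) : hcomp (hid X) M x y ⟶ M x y :=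
  desc fun x' => unitDescR fun h => (λ_ _).hom ≫ eqToHom (by rw [h])

/-- Inverse left unitor. -/
noncomputable def lunitInv (M : X → Y → V) (x : X) (y : Y) : M x y ⟶ hcomp (hid X) M x y :=
  (λ_ _).inv ≫ unitInj rfl ▷ M x y ≫ inj (hid X) M x x y

/-- Right unitor. -/
noncomputable def runit (M : X → Y → V) (x : X) (y : Y) : hcomp M (hid Y) x y ⟶ M x y :=
  desc fun y' => unitDescL fun h => (ρ_ _).hom ≫ eqToHom (by rw [h])

/-- Inverse right unitor. -/
noncomputable def runitInv (M : X → Y → V) (x : X) (y : Y) : M x y ⟶ hcomp M (hid Y) x y :=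
  (ρ_ _).inv ≫ M x y ◁ unitInj rfl ≫ inj M (hid Y) x y y

lemma inj_assoc (M : X → Y → V) (N : Y → Z → V) (Q : Z → W → V) (x : X) (y : Y) (z : Z) (t : W)
    {A : V} (k : hcomp M (hcomp N Q) x t ⟶ A) :
    inj M N x y z ▷ Q z t ≫ inj (hcomp M N) Q x z t ≫ assoc M N Q x t ≫ k =
      (α_ _ _ _).hom ≫ M x y ◁ inj N Q y z t ≫ inj M (hcomp N Q) x y t ≫ k := by
  simp only [assoc, inj_desc_assoc, inj_descR_assoc, Category.assoc]

lemma inj_assoc' (M : X → Y → V) (N : Y → Z → V) (Q : Z → W → V) (x : X) (y : Y) (z : Z) (t : W) :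
    inj M N x y z ▷ Q z t ≫ inj (hcomp M N) Q x z t ≫ assoc M N Q x t =
      (α_ _ _ _).hom ≫ M x y ◁ inj N Q y z t ≫ inj M (hcomp N Q) x y t := by
  simpa using inj_assoc M N Q x y z t (𝟙 _)

lemma inj_assocInv (M : X → Y → V) (N : Y → Z → V) (Q : Z → W → V) (x : X) (y : Y) (z : Z)
    (t : W) {A : V} (k : hcomp (hcomp M N) Q x t ⟶ A) :
    M x y ◁ inj N Q y z t ≫ inj M (hcomp N Q) x y t ≫ assocInv M N Q x t ≫ k =
      (α_ _ _ _).inv ≫ inj M N x y z ▷ Q z t ≫ inj (hcomp M N) Q x z t ≫ k := by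
  simp only [assocInv, inj_desc_assoc, inj_descL_assoc, Category.assoc]

lemma inj_lunit (M : X → Y → V) (x : X) (y : Y) {A : V} (k : M x y ⟶ A) :
    unitInj rfl ▷ M x y ≫ inj (hid X) M x x y ≫ lunit M x y ≫ k = (λ_ _).hom ≫ k := by
  simp only [lunit, inj_desc_assoc, unitInj_descR_assoc, eqToHom_refl, Category.comp_id]

lemma inj_lunit' (M : X → Y → V) (x : X) (y : Y) :
    unitInj rfl ▷ M x y ≫ inj (hid X) M x x y ≫ lunit M x y = (λ_ _).hom := by
  simpa using inj_lunit M x y (𝟙 _)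

lemma inj_runit (M : X → Y → V) (x : X) (y : Y) {A : V} (k : M x y ⟶ A) :
    M x y ◁ unitInj rfl ≫ inj M (hid Y) x y y ≫ runit M x y ≫ k = (ρ_ _).hom ≫ k := by
  simp only [runit, inj_desc_assoc, unitInj_descL_assoc, eqToHom_refl, Category.comp_id]

lemma inj_runit' (M : X → Y → V) (x : X) (y : Y) :
    M x y ◁ unitInj rfl ≫ inj M (hid Y) x y y ≫ runit M x y = (ρ_ _).hom := by
  simpa using inj_runit M x y (𝟙 _)

lemma hcompCell_vid (M : X → Y → V) (N : Y → Z → V) :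
    hcompCell (f := fun x => x) (g := fun y => y) (h := fun z => z)
      (fun x y => 𝟙 (M x y)) (fun y z => 𝟙 (N y z)) = fun x z => 𝟙 (hcomp M N x z) := by
  funext x z
  apply hcomp_ext
  intro y
  rw [inj_hcompCell]
  simp

lemma hcompCell_vcomp {X'' Y'' Z'' : Type w} {f : X → X'} {g : Y → Y'} {h : Z → Z'}
    {f' : X' → X''} {g' : Y' → Y''} {h' : Z' → Z''}
    {M : X → Y → V} {M' : X' → Y' → V} {M'' : X'' → Y'' → V}
    {N : Y → Z → V} {N' : Y' → Z' → V} {N'' : Y'' → Z'' → V}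
    (α : Cell f g M M') (α' : Cell f' g' M' M'') (β : Cell g h N N') (β' : Cell g' h' N' N'') :
    hcompCell (f := fun x => f' (f x)) (g := fun y => g' (g y)) (h := fun z => h' (h z))
        (fun x y => α x y ≫ α' (f x) (g y)) (fun y z => β y z ≫ β' (g y) (h z)) =
      fun x z => hcompCell α β x z ≫ hcompCell α' β' (f x) (h z) := by
  funext x z
  apply hcomp_ext
  intro y
  rw [inj_hcompCell, inj_hcompCell_assoc, inj_hcompCell]
  simp

lemma hidCell_id (X : Type w) :
    hidCell (V := V) (fun x : X => x) = fun x x' => 𝟙 (hid X x x') := by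
  funext x x'
  apply unit_ext
  intro e
  rw [unitInj_hidCell]
  simp

lemma hidCell_comp {X'' : Type w} (f : X → X') (f' : X' → X'') :
    hidCell (V := V) (fun x => f' (f x)) =
      fun x x' => hidCell f x x' ≫ hidCell f' (f x) (f x') := by
  funext x x'
  apply unit_ext
  intro e
  rw [unitInj_hidCell, ← Category.assoc, unitInj_hidCell, unitInj_hidCell]

lemma assoc_assocInv (M : X → Y → V) (N : Y → Z → V) (Q : Z → W → V) (x : X) (t : W) :
    assoc M N Q x t ≫ assocInv M N Q x t = 𝟙 _ := by
  apply hcomp_ext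
  intro z
  apply hcompR_ext
  intro y
  have := inj_assocInv M N Q x y z t (𝟙 _)
  simp only [Category.comp_id] at this
  rw [inj_assoc, this]
  simp

lemma assocInv_assoc (M : X → Y → V) (N : Y → Z → V) (Q : Z → W → V) (x : X) (t : W) :
    assocInv M N Q x t ≫ assoc M N Q x t = 𝟙 _ := by
  apply hcomp_ext
  intro z
  apply hcompL_ext
  intro y
  rw [inj_assocInv, inj_assoc']
  simp

lemma lunit_lunitInv (M : X → Y → V) (x : X) (y : Y) : lunit M x y ≫ lunitInv M x y = 𝟙 _ := by
  apply hcomp_ext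
  intro x'
  apply unitR_ext
  intro e
  cases e
  rw [inj_lunit, lunitInv]
  simp

lemma lunitInv_lunit (M : X → Y → V) (x : X) (y : Y) : lunitInv M x y ≫ lunit M x y = 𝟙 _ := by
  rw [lunitInv, Category.assoc, Category.assoc, inj_lunit']
  simp

lemma runit_runitInv (M : X → Y → V) (x : X) (y : Y) : runit M x y ≫ runitInv M x y = 𝟙 _ := by
  apply hcomp_ext
  intro x'
  apply unitL_ext
  intro e
  cases e
  rw [inj_runit, runitInv]
  simp

lemma runitInv_runit (M : X → Y → V) (x : X) (y : Y) : runitInv M x y ≫ runit M x y = 𝟙 _ := by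
  rw [runitInv, Category.assoc, Category.assoc, inj_runit']
  simp

lemma assoc_naturality {W' : Type w} {f : X → X'} {g : Y → Y'} {h : Z → Z'} {k : W → W'}
    {M : X → Y → V} {M' : X' → Y' → V} {N : Y → Z → V} {N' : Y' → Z' → V}
    {Q : Z → W → V} {Q' : Z' → W' → V}
    (α : Cell f g M M') (β : Cell g h N N') (γ : Cell h k Q Q') (x : X) (t : W) :
    hcompCell (hcompCell α β) γ x t ≫ assoc M' N' Q' (f x) (k t) =
      assoc M N Q x t ≫ hcompCell α (hcompCell β γ) x t := by
  apply hcomp_ext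
  intro z
  apply hcompR_ext
  intro y
  rw [inj_assoc, inj_hcompCell_assoc, inj_hcompCell, MonoidalCategory.tensorHom_def (hcompCell _ _ _ _),
    MonoidalCategory.tensorHom_def' (α x y) (hcompCell _ _ _ _)]
  simp only [Category.assoc]
  rw [← comp_whiskerRight_assoc, ← whiskerLeft_comp_assoc, inj_hcompCell, inj_hcompCell,
    comp_whiskerRight_assoc, MonoidalCategory.whiskerLeft_comp_assoc, ← whisker_exchange_assoc,
    inj_assoc', whisker_exchange_assoc]
  simp only [MonoidalCategory.tensorHom_def, comp_whiskerRight, Category.assoc,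
    associator_naturality_left_assoc, associator_naturality_middle_assoc,
    associator_naturality_right_assoc, MonoidalCategory.whiskerLeft_comp, whisker_exchange_assoc]

lemma lunit_naturality {f : X → X'} {g : Y → Y'} {M : X → Y → V} {M' : X' → Y' → V}
    (α : Cell f g M M') (x : X) (y : Y) :
    hcompCell (hidCell f) α x y ≫ lunit M' (f x) (g y) = lunit M x y ≫ α x y := by
  apply hcomp_ext
  intro x'
  apply unitR_ext
  intro e
  cases e
  rw [inj_lunit, inj_hcompCell_assoc]
  simp only [MonoidalCategory.tensorHom_def, Category.assoc, ← comp_whiskerRight_assoc, unitInj_hidCell]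
  rw [← whisker_exchange_assoc, inj_lunit']
  simp

lemma runit_naturality {f : X → X'} {g : Y → Y'} {M : X → Y → V} {M' : X' → Y' → V}
    (α : Cell f g M M') (x : X) (y : Y) :
    hcompCell α (hidCell g) x y ≫ runit M' (f x) (g y) = runit M x y ≫ α x y := by
  apply hcomp_ext
  intro y'
  apply unitL_ext
  intro e
  cases e
  rw [inj_runit, inj_hcompCell_assoc]
  simp only [MonoidalCategory.tensorHom_def', Category.assoc, ← whiskerLeft_comp_assoc, unitInj_hidCell]
  rw [whisker_exchange_assoc, inj_runit']
  simp

lemma pentagon (M : X → Y → V) (N : Y → Z → V) (Q : Z → W → V) (R : W → T → V) (x : X) (s : T) :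
    assoc (hcomp M N) Q R x s ≫ assoc M N (hcomp Q R) x s =
      hcompCell (f := fun x => x) (g := fun y => y) (h := fun z => z)
          (assoc M N Q) (fun t s => 𝟙 (R t s)) x s ≫
        assoc M (hcomp N Q) R x s ≫
          hcompCell (f := fun x => x) (g := fun y => y) (h := fun z => z)
            (fun x y => 𝟙 (M x y)) (assoc N Q R) x s := by
  apply hcomp_ext
  intro t
  apply hcompR_ext
  intro z
  apply hcompRR_ext
  intro y
  rw [inj_assoc, associator_naturality_left_assoc, ← whisker_exchange_assoc, inj_assoc',
    inj_hcompCell_assoc]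
  have h₁ := congrArg (· ▷ R t s) (inj_assoc' M N Q x y z t)
  have h₂ := congrArg (M x y ◁ ·) (inj_assoc' N Q R y z t s)
  simp only [comp_whiskerRight, MonoidalCategory.whiskerLeft_comp] at h₁ h₂
  rw [tensorHom_id, reassoc_of% h₁, inj_assoc, inj_hcompCell, id_tensorHom,
    associator_naturality_middle_assoc, reassoc_of% h₂, pentagon_assoc,
    associator_naturality_right_assoc]

lemma triangle (M : X → Y → V) (N : Y → Z → V) (x : X) (z : Z) :
    assoc M (hid Y) N x z ≫
        hcompCell (f := fun x => x) (g := fun y => y) (h := fun z => z)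
          (fun x y => 𝟙 (M x y)) (lunit N) x z =
      hcompCell (f := fun x => x) (g := fun y => y) (h := fun z => z)
          (runit M) (fun y z => 𝟙 (N y z)) x z := by
  apply hcomp_ext
  intro y'
  apply hcompR_ext
  intro y
  apply unitLR_ext
  intro e
  cases e
  have h₁ := congrArg (M x y' ◁ ·) (inj_lunit' N y' z)
  simp only [MonoidalCategory.whiskerLeft_comp] at h₁
  have h₂ := congrArg (· ▷ N y' z) (inj_runit' M x y')
  simp only [comp_whiskerRight] at h₂
  rw [inj_hcompCell, tensorHom_id, reassoc_of% h₂, inj_assoc, inj_hcompCell, id_tensorHom,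
    associator_naturality_middle_assoc, reassoc_of% h₁]
  simp

end

end VMat

/-- The double category of matrices with entries in `V`: objects are sets, arrows are functions,
proarrows `X ⇸ Y` are families of objects of `V` indexed by `X × Y`, and cells are families of
morphisms of `V`. -/
noncomputable def VMat (V : Type u) [Category.{v} V] [MonoidalCategory V]
    [DistributiveMonoidal.{w} V] : DblCat.{w + 1, w, max w u, max w v} where
  Obj := Type w
  Pro X Y := X → Y → V
  Cell f g M N := ∀ x y, M x y ⟶ N (f x) (g y)
  vid M := fun x y => 𝟙 (M x y)
  vcomp {_ _ _ _ _ _ f _ g _ _ _ _} α β := fun x y => α x y ≫ β (f x) (g y)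
  hid X := VMat.hid X
  hcomp M N := VMat.hcomp M N
  hidCell f := VMat.hidCell f
  hcompCell α β := VMat.hcompCell α β
  assoc M N Q := VMat.assoc M N Q
  assocInv M N Q := VMat.assocInv M N Q
  lunit M := VMat.lunit M
  lunitInv M := VMat.lunitInv M
  runit M := VMat.runit M
  runitInv M := VMat.runitInv M
  vid_vcomp α := heq_of_eq (by funext x y; exact Category.id_comp _)
  vcomp_vid α := heq_of_eq (by funext x y; exact Category.comp_id _)
  vcomp_vcomp α β γ := heq_of_eq (by funext x y; exact Category.assoc _ _ _)
  hcompCell_vid M N := VMat.hcompCell_vid M N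
  hcompCell_vcomp α α' β β' := VMat.hcompCell_vcomp α α' β β'
  hidCell_id X := VMat.hidCell_id X
  hidCell_comp f f' := VMat.hidCell_comp f f'
  assoc_assocInv M N Q := heq_of_eq (by funext x t; exact VMat.assoc_assocInv M N Q x t)
  assocInv_assoc M N Q := heq_of_eq (by funext x t; exact VMat.assocInv_assoc M N Q x t)
  lunit_lunitInv M := heq_of_eq (by funext x y; exact VMat.lunit_lunitInv M x y)
  lunitInv_lunit M := heq_of_eq (by funext x y; exact VMat.lunitInv_lunit M x y)
  runit_runitInv M := heq_of_eq (by funext x y; exact VMat.runit_runitInv M x y)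
  runitInv_runit M := heq_of_eq (by funext x y; exact VMat.runitInv_runit M x y)
  assoc_naturality α β γ := heq_of_eq (by funext x t; exact VMat.assoc_naturality α β γ x t)
  lunit_naturality α := heq_of_eq (by funext x y; exact VMat.lunit_naturality α x y)
  runit_naturality α := heq_of_eq (by funext x y; exact VMat.runit_naturality α x y)
  pentagon M N Q R := heq_of_eq (by funext x s; exact VMat.pentagon M N Q R x s)
  triangle M N := heq_of_eq (by funext x z; exact VMat.triangle M N x z)

namespace VMat

variable {V : Type u} [Category.{v} V] [MonoidalCategory V] [DistributiveMonoidal.{w} V]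

/-- The set underlying an object of the double category of matrices. -/
abbrev Carrier (X : (VMat.{w} V).Obj) : Type w := X

/-- The function underlying an arrow of the double category of matrices. -/
abbrev fn {X Y : (VMat.{w} V).Obj} (f : X ⟶ Y) : Carrier X → Carrier Y :=
  fun x => (show (Carrier X : Type w) ⟶ Carrier Y from f) x

/-- The entries of a matrix. -/
abbrev entry {X Y : (VMat.{w} V).Obj} (M : (VMat.{w} V).Pro X Y) (x : Carrier X) (y : Carrier Y) :
    V :=
  M x y

/-- The entries of a cell of matrices. -/
abbrev cellEntry {X X' Y Y' : (VMat.{w} V).Obj} {f : X ⟶ X'} {g : Y ⟶ Y'}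
    {M : (VMat.{w} V).Pro X Y} {N : (VMat.{w} V).Pro X' Y'} (α : (VMat.{w} V).Cell f g M N)
    (x : Carrier X) (y : Carrier Y) : entry M x y ⟶ entry N (fn f x) (fn g y) :=
  α x y

end VMat

/-! The left adjoint is explicit. A family of sets goes to its disjoint union, and a family of
matrices indexed by a span `A` goes to the block matrix whose entry at `((i, x), (j, y))` is the
coproduct of the `M_a(x, y)` over all `a : i ⇸ j`. The comparison `Σ(M ⊙ N) ⟶ ΣM ⊙ ΣN` is built from
coprojections. It is invertible because the tensor distributes over coproducts: an entry of the
codomain is then the coproduct of `M_a(x, y) ⊗ N_b(y, z)` over all `j`, `y`, `a : i ⇸ j`, `b : j ⇸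
k`, and so is the entry of the domain, an element of the pullback span being a composable pair
(`sigmaCompCell_inv`, `sigmaCompInv_cell`). For identities, `(i, x) = (j, x')` forces `i = j` and `x
= x'`, so both sides have a unit on the diagonal and are initial elsewhere. Every coherence law is
checked on the jointly epic generating coprojections, where it becomes a fact about the tensor
product of `V`.

The statement about an arbitrary left adjoint is formal up to its last step. In any double category,
transposition makes `ΣX` a coproduct, and identifies cells `ΣM ⟶ N` with sides `f`, `g` with
families of cells `M_a ⟶ N` whose sides are the coprojections followed by `f`, `g` (`cell_hom_ext`,
`exists_cell_desc`). For matrices, with `f` and `g` identities, this is a universal property of the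
whole matrix `ΣM`. To isolate one entry, `isColimit_cofan_of_cells` tests it against `ΣM` itself
with that single entry replaced by an arbitrary object. The coprojections of sets are jointly
injective (`objCoproj_injective`), so only the `M_a(x, y)` with `a : i ⇸ j` reach the entry at `(ι_i
x, ι_j y)`. -/

namespace VMat

/-! ### Coproducts of families of matrices -/

section Sigma

variable {V : Type u} [Category.{v} V] [MonoidalCategory V] [DistributiveMonoidal.{w} V]
  {I J K L : Type w} {X : I → Type w} {Y : J → Type w} {Z : K → Type w} {W : L → Type w}
  {A : SetSpan I J} {B : SetSpan J K} {C : SetSpan K L}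

/-- Families of matrices indexed by a span. -/
abbrev SpanFam (V : Type u) {I J : Type w} (X : I → Type w) (Y : J → Type w) (A : SetSpan I J) :
    Type (max w u) :=
  ∀ ⦃i : I⦄ ⦃j : J⦄, A.Elt i j → X i → Y j → V

/-- The coproduct of a family of matrices. -/
noncomputable def sigmaPro (M : SpanFam V X Y A) (p : Σ i, X i) (q : Σ j, Y j) : V :=
  ∐ fun a : A.Elt p.1 q.1 => M a p.2 q.2

/-- The coprojections of a coproduct of a family of matrices. -/
noncomputable def sigmaInj (M : SpanFam V X Y A) {i : I} {j : J} (a : A.Elt i j) (x : X i)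
    (y : Y j) : M a x y ⟶ sigmaPro M ⟨i, x⟩ ⟨j, y⟩ :=
  Sigma.ι (fun a : A.Elt i j => M a x y) a

/-- Morphisms out of an entry of a coproduct of a family of matrices. -/
noncomputable def sigmaDesc {M : SpanFam V X Y A} {p : Σ i, X i} {q : Σ j, Y j} {T : V}
    (φ : ∀ a : A.Elt p.1 q.1, M a p.2 q.2 ⟶ T) : sigmaPro M p q ⟶ T :=
  Sigma.desc φ

section

variable {M : SpanFam V X Y A} {i : I} {j : J} {x : X i} {y : Y j} {T U : V}

lemma sigmaInj_desc (φ : ∀ a : A.Elt i j, M a x y ⟶ T) (a : A.Elt i j) :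
    sigmaInj M a x y ≫ sigmaDesc (p := ⟨i, x⟩) (q := ⟨j, y⟩) φ = φ a :=
  Sigma.ι_desc φ a

lemma sigma_ext {f g : sigmaPro M ⟨i, x⟩ ⟨j, y⟩ ⟶ T}
    (h : ∀ a : A.Elt i j, sigmaInj M a x y ≫ f = sigmaInj M a x y ≫ g) : f = g :=
  Sigma.hom_ext _ _ h

/-- Morphisms out of a tensor product of entries of coproducts of families of matrices. -/
noncomputable def sigmaTensorDesc {M : SpanFam V X Y A} {N : SpanFam V Y Z B} {p : Σ i, X i}
    {q : Σ j, Y j} {r : Σ k, Z k}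
    (φ : ∀ (a : A.Elt p.1 q.1) (b : B.Elt q.1 r.1), M a p.2 q.2 ⊗ N b q.2 r.2 ⟶ T) :
    sigmaPro M p q ⊗ sigmaPro N q r ⟶ T :=
  sumDescR _ _ fun a => sumDescL _ _ fun b => φ a b

lemma sigmaInj_tensorDesc {N : SpanFam V Y Z B} {k : K} {z : Z k}
    (φ : ∀ (a : A.Elt i j) (b : B.Elt j k), M a x y ⊗ N b y z ⟶ T) (a : A.Elt i j)
    (b : B.Elt j k) :
    (sigmaInj M a x y ⊗ₘ sigmaInj N b y z) ≫
      sigmaTensorDesc (p := ⟨i, x⟩) (q := ⟨j, y⟩) (r := ⟨k, z⟩) φ = φ a b := by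
  rw [MonoidalCategory.tensorHom_def', Category.assoc]
  erw [ι_sumDescR, ι_sumDescL]

/-- Distributivity in each variable: a tensor product of two coproducts is the coproduct of the
tensor products, so the tensored coprojections are jointly epic. -/
lemma sigmaTensor_ext {N : SpanFam V Y Z B} {k : K} {z : Z k}
    {f g : sigmaPro M ⟨i, x⟩ ⟨j, y⟩ ⊗ sigmaPro N ⟨j, y⟩ ⟨k, z⟩ ⟶ T}
    (h : ∀ (a : A.Elt i j) (b : B.Elt j k), (sigmaInj M a x y ⊗ₘ sigmaInj N b y z) ≫ f =
      (sigmaInj M a x y ⊗ₘ sigmaInj N b y z) ≫ g) : f = g := by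
  refine sumR_ext _ _ fun a => sumL_ext _ _ fun b => ?_
  have := h a b
  -- This factorization puts the whiskered coprojection of the second factor outermost, matching the
  -- order in which the two extensionality lemmas were applied.
  rwa [MonoidalCategory.tensorHom_def', Category.assoc, Category.assoc] at this

end

/-! ### Coproducts of families of cells -/

/-- The function between disjoint unions induced by a family of functions. -/
abbrev sigmaMap {I' : Type w} {X' : I' → Type w} (f : I → I') (F : ∀ i, X i → X' (f i))
    (p : Σ i, X i) : Σ i, X' i :=
  ⟨f p.1, F p.1 p.2⟩

section

variable {I' J' K' : Type w} {X' : I' → Type w} {Y' : J' → Type w} {Z' : K' → Type w}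
  {A' : SetSpan I' J'} {B' : SetSpan J' K'}
  {f : I → I'} {g : J → J'} {h : K → K'}
  {F : ∀ i, X i → X' (f i)} {G : ∀ j, Y j → Y' (g j)} {H : ∀ k, Z k → Z' (h k)}

/-- The coproduct of a family of cells. -/
noncomputable def sigmaCell {M : SpanFam V X Y A} {M' : SpanFam V X' Y' A'}
    (φ : SetSpan.Map f g A A')
    (α : ∀ ⦃i j⦄ (a : A.Elt i j), Cell (F i) (G j) (M a) (M' (φ.elt a))) :
    Cell (sigmaMap f F) (sigmaMap g G) (sigmaPro M) (sigmaPro M') :=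
  fun p q => sigmaDesc fun a => α a p.2 q.2 ≫ sigmaInj M' (φ.elt a) (F p.1 p.2) (G q.1 q.2)

variable {M : SpanFam V X Y A} {M' : SpanFam V X' Y' A'}
  {N : SpanFam V Y Z B} {N' : SpanFam V Y' Z' B'}

lemma sigmaInj_cell (φ : SetSpan.Map f g A A')
    (α : ∀ ⦃i j⦄ (a : A.Elt i j), Cell (F i) (G j) (M a) (M' (φ.elt a)))
    {i : I} {j : J} (a : A.Elt i j) (x : X i) (y : Y j) :
    sigmaInj M a x y ≫ sigmaCell φ α ⟨i, x⟩ ⟨j, y⟩ =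
      α a x y ≫ sigmaInj M' (φ.elt a) (F i x) (G j y) :=
  sigmaInj_desc _ _

lemma sigmaInj_cell_assoc (φ : SetSpan.Map f g A A')
    (α : ∀ ⦃i j⦄ (a : A.Elt i j), Cell (F i) (G j) (M a) (M' (φ.elt a)))
    {i : I} {j : J} (a : A.Elt i j) (x : X i) (y : Y j) {T : V}
    (k : sigmaPro M' ⟨f i, F i x⟩ ⟨g j, G j y⟩ ⟶ T) :
    sigmaInj M a x y ≫ sigmaCell φ α ⟨i, x⟩ ⟨j, y⟩ ≫ k =
      α a x y ≫ sigmaInj M' (φ.elt a) (F i x) (G j y) ≫ k := by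
  rw [← Category.assoc, sigmaInj_cell, Category.assoc]

end

/-! ### Comparison of the coproduct with composition -/

/-- The composite of families of matrices. -/
noncomputable abbrev compFam (M : SpanFam V X Y A) (N : SpanFam V Y Z B) :
    SpanFam V X Z (A.comp B) :=
  fun _ _ e => hcomp (M e.fst) (N e.snd)

/-- Pairs of composable elements of spans are elements of the composite span. -/
abbrev eltComp {i : I} {j : J} {k : K} (a : A.Elt i j) (b : B.Elt j k) : (A.comp B).Elt i k :=
  ⟨⟨j, a.1, b.1, a.2.2, b.2.1⟩, a.2.1, b.2.2⟩

/-- The middle element is a field of the pullback, so by eta every element is definitionally an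
`eltComp` of its two components and no transport occurs. -/
lemma eltComp_cases {i : I} {k : K} {P : (A.comp B).Elt i k → Prop}
    (h : ∀ (j : J) (a : A.Elt i j) (b : B.Elt j k), P (eltComp a b)) (e : (A.comp B).Elt i k) :
    P e :=
  h _ e.fst e.snd

/-- The coprojections of the coproduct of a composite of families of matrices. -/
noncomputable def prodInj (M : SpanFam V X Y A) (N : SpanFam V Y Z B) {i : I} {j : J} {k : K}
    (a : A.Elt i j) (b : B.Elt j k) (x : X i) (z : Z k) :
    hcomp (M a) (N b) x z ⟶ sigmaPro (compFam M N) ⟨i, x⟩ ⟨k, z⟩ :=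
  sigmaInj (compFam M N) (eltComp a b) x z

/-- The coprojections of the coproduct of a composite of families of matrices. -/
noncomputable def compInj (M : SpanFam V X Y A) (N : SpanFam V Y Z B) {i : I} {j : J} {k : K}
    (a : A.Elt i j) (b : B.Elt j k) (x : X i) (y : Y j) (z : Z k) :
    M a x y ⊗ N b y z ⟶ sigmaPro (compFam M N) ⟨i, x⟩ ⟨k, z⟩ :=
  inj (M a) (N b) x y z ≫ prodInj M N a b x z

lemma inj_prodInj (M : SpanFam V X Y A) (N : SpanFam V Y Z B) {i : I} {j : J} {k : K}
    (a : A.Elt i j) (b : B.Elt j k) (x : X i) (y : Y j) (z : Z k) :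
    inj (M a) (N b) x y z ≫ prodInj M N a b x z = compInj M N a b x y z :=
  rfl

lemma prodInj_sigmaDesc {M : SpanFam V X Y A} {N : SpanFam V Y Z B} {i : I} {j : J} {k : K}
    {x : X i} {z : Z k} {T : V} (φ : ∀ e : (A.comp B).Elt i k, compFam M N e x z ⟶ T)
    (a : A.Elt i j) (b : B.Elt j k) :
    prodInj M N a b x z ≫ sigmaDesc (M := compFam M N) (p := ⟨i, x⟩) (q := ⟨k, z⟩) φ =
      φ (eltComp a b) :=
  sigmaInj_desc _ _

/-- A coproduct over composable pairs `(a, b)` of coproducts over `y` is generated by the summands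
`M_a(x, y) ⊗ N_b(y, z)`. Equations out of the coproduct of a composite are verified through this
lemma. -/
lemma compFam_ext {M : SpanFam V X Y A} {N : SpanFam V Y Z B} {i : I} {k : K} {x : X i} {z : Z k}
    {T : V} {s t : sigmaPro (compFam M N) ⟨i, x⟩ ⟨k, z⟩ ⟶ T}
    (h : ∀ (j : J) (a : A.Elt i j) (b : B.Elt j k) (y : Y j),
      compInj M N a b x y z ≫ s = compInj M N a b x y z ≫ t) : s = t := by
  refine sigma_ext (eltComp_cases fun j a b => hcomp_ext fun y => ?_)
  exact (Category.assoc _ _ _).symm.trans ((h j a b y).trans (Category.assoc _ _ _))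

/-- The comparison of the coproduct of a composite with the composite of coproducts. -/
noncomputable def sigmaCompCell (M : SpanFam V X Y A) (N : SpanFam V Y Z B) (p : Σ i, X i)
    (r : Σ k, Z k) : sigmaPro (compFam M N) p r ⟶ hcomp (sigmaPro M) (sigmaPro N) p r :=
  sigmaDesc fun e => desc fun y =>
    (sigmaInj M e.fst p.2 y ⊗ₘ sigmaInj N e.snd y r.2) ≫
      inj (sigmaPro M) (sigmaPro N) p ⟨e.1.mid, y⟩ r

/-- The inverse of `sigmaCompCell`. -/
noncomputable def sigmaCompInv (M : SpanFam V X Y A) (N : SpanFam V Y Z B) (p : Σ i, X i)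
    (r : Σ k, Z k) : hcomp (sigmaPro M) (sigmaPro N) p r ⟶ sigmaPro (compFam M N) p r :=
  desc fun q => sigmaTensorDesc fun a b => compInj M N a b p.2 q.2 r.2

section

variable (M : SpanFam V X Y A) (N : SpanFam V Y Z B) {i : I} {j : J} {k : K}
  (a : A.Elt i j) (b : B.Elt j k) (x : X i) (y : Y j) (z : Z k)

lemma compInj_sigmaCompCell :
    compInj M N a b x y z ≫ sigmaCompCell M N ⟨i, x⟩ ⟨k, z⟩ =
      (sigmaInj M a x y ⊗ₘ sigmaInj N b y z) ≫
        inj (sigmaPro M) (sigmaPro N) ⟨i, x⟩ ⟨j, y⟩ ⟨k, z⟩ := by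
  rw [compInj, sigmaCompCell, Category.assoc, prodInj_sigmaDesc]
  exact inj_desc _ _

lemma compInj_sigmaCompCell_assoc {T : V}
    (t : hcomp (sigmaPro M) (sigmaPro N) ⟨i, x⟩ ⟨k, z⟩ ⟶ T) :
    compInj M N a b x y z ≫ sigmaCompCell M N ⟨i, x⟩ ⟨k, z⟩ ≫ t =
      (sigmaInj M a x y ⊗ₘ sigmaInj N b y z) ≫
        inj (sigmaPro M) (sigmaPro N) ⟨i, x⟩ ⟨j, y⟩ ⟨k, z⟩ ≫ t := by
  rw [← Category.assoc, compInj_sigmaCompCell, Category.assoc]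

/-- With `compInj_sigmaCompCell`, this shows that the two candidate inverses exchange the generators
indexed by the same `(a, b, y)`. -/
lemma tensor_inj_sigmaCompInv :
    (sigmaInj M a x y ⊗ₘ sigmaInj N b y z) ≫
        inj (sigmaPro M) (sigmaPro N) ⟨i, x⟩ ⟨j, y⟩ ⟨k, z⟩ ≫ sigmaCompInv M N ⟨i, x⟩ ⟨k, z⟩ =
      compInj M N a b x y z := by
  rw [sigmaCompInv, inj_desc, sigmaInj_tensorDesc]

end

lemma sigmaCompCell_inv (M : SpanFam V X Y A) (N : SpanFam V Y Z B) (p : Σ i, X i)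
    (r : Σ k, Z k) : sigmaCompCell M N p r ≫ sigmaCompInv M N p r = 𝟙 _ := by
  obtain ⟨i, x⟩ := p
  obtain ⟨k, z⟩ := r
  refine compFam_ext fun j a b y => ?_
  rw [compInj_sigmaCompCell_assoc, tensor_inj_sigmaCompInv, Category.comp_id]

/-- The generators of `ΣM ⊙ ΣN` are jointly epic only thanks to distributivity, which enters through
`sigmaTensor_ext`. -/
lemma sigmaCompInv_cell (M : SpanFam V X Y A) (N : SpanFam V Y Z B) (p : Σ i, X i)
    (r : Σ k, Z k) : sigmaCompInv M N p r ≫ sigmaCompCell M N p r = 𝟙 _ := by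
  obtain ⟨i, x⟩ := p
  obtain ⟨k, z⟩ := r
  refine hcomp_ext fun q => ?_
  obtain ⟨j, y⟩ := q
  refine sigmaTensor_ext fun a b => ?_
  have := congrArg (· ≫ sigmaCompCell M N ⟨i, x⟩ ⟨k, z⟩) (tensor_inj_sigmaCompInv M N a b x y z)
  simp only [Category.assoc] at this
  rw [this, compInj_sigmaCompCell, Category.comp_id]

section

variable {I' J' K' : Type w} {X' : I' → Type w} {Y' : J' → Type w} {Z' : K' → Type w}
  {A' : SetSpan I' J'} {B' : SetSpan J' K'}
  {f : I → I'} {g : J → J'} {h : K → K'}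
  {F : ∀ i, X i → X' (f i)} {G : ∀ j, Y j → Y' (g j)} {H : ∀ k, Z k → Z' (h k)}
  {M : SpanFam V X Y A} {M' : SpanFam V X' Y' A'}
  {N : SpanFam V Y Z B} {N' : SpanFam V Y' Z' B'}

/-- The composite of maps of spans. -/
abbrev mapComp (φ : SetSpan.Map f g A A') (ψ : SetSpan.Map g h B B') :
    SetSpan.Map f h (A.comp B) (A'.comp B') :=
  ⟨fun e => ⟨g e.mid, φ.map e.fst, ψ.map e.snd,
      (φ.map_r _).trans (congrArg g e.fst_r), (ψ.map_l _).trans (congrArg g e.snd_l)⟩,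
    fun e => φ.map_l e.fst, fun e => ψ.map_r e.snd⟩

lemma compInj_sigmaCell (φ : SetSpan.Map f g A A') (ψ : SetSpan.Map g h B B')
    (α : ∀ ⦃i j⦄ (a : A.Elt i j), Cell (F i) (G j) (M a) (M' (φ.elt a)))
    (β : ∀ ⦃j k⦄ (b : B.Elt j k), Cell (G j) (H k) (N b) (N' (ψ.elt b)))
    {i : I} {j : J} {k : K} (a : A.Elt i j) (b : B.Elt j k) (x : X i) (y : Y j) (z : Z k) :
    compInj M N a b x y z ≫ sigmaCell (F := F) (G := H) (M := compFam M N) (M' := compFam M' N')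
        (mapComp φ ψ) (fun _ _ e => hcompCell (α e.fst) (β e.snd)) ⟨i, x⟩ ⟨k, z⟩ =
      (α a x y ⊗ₘ β b y z) ≫ compInj M' N' (φ.elt a) (ψ.elt b) (F i x) (G j y) (H k z) := by
  rw [compInj, Category.assoc]
  -- The member of `compFam M N` at `eltComp a b` is `hcomp (M a) (N b)` only by unfolding, so the
  -- equation is supplied as a term and matched up to definitional equality.
  refine (congrArg (inj _ _ x y z ≫ ·) (sigmaInj_cell _ _ (eltComp a b) x z)).trans ?_
  exact inj_hcompCell_assoc _ _ _ _ _ _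

/-- On a generator, both sides are the tensor of `α` and `β`, each followed by its coprojection, and
then the coprojection into the product matrix; functoriality of the tensor identifies them. -/
lemma sigmaCompCell_naturality (φ : SetSpan.Map f g A A') (ψ : SetSpan.Map g h B B')
    (α : ∀ ⦃i j⦄ (a : A.Elt i j), Cell (F i) (G j) (M a) (M' (φ.elt a)))
    (β : ∀ ⦃j k⦄ (b : B.Elt j k), Cell (G j) (H k) (N b) (N' (ψ.elt b)))
    (p : Σ i, X i) (r : Σ k, Z k) :
    sigmaCell (F := F) (G := H) (M := compFam M N) (M' := compFam M' N') (mapComp φ ψ)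
        (fun _ _ e => hcompCell (α e.fst) (β e.snd)) p r ≫
        sigmaCompCell M' N' (sigmaMap f F p) (sigmaMap h H r) =
      sigmaCompCell M N p r ≫ hcompCell (sigmaCell φ α) (sigmaCell ψ β) p r := by
  obtain ⟨i, x⟩ := p
  obtain ⟨k, z⟩ := r
  refine compFam_ext fun j a b y => ?_
  rw [compInj_sigmaCompCell_assoc, inj_hcompCell, MonoidalCategory.tensorHom_comp_tensorHom_assoc,
    sigmaInj_cell, sigmaInj_cell, ← Category.assoc, compInj_sigmaCell, Category.assoc,
    compInj_sigmaCompCell, MonoidalCategory.tensorHom_comp_tensorHom_assoc]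

end

/-! ### Compatibility of the comparison with associators -/

/-- The associator map of spans. -/
abbrev assocMap (A : SetSpan I J) (B : SetSpan J K) (C : SetSpan K L) :
    SetSpan.Map (fun i => i) (fun l => l) ((A.comp B).comp C) (A.comp (B.comp C)) :=
  ⟨fun e => ⟨e.fst.mid, e.fst.fst, ⟨e.mid, e.fst.snd, e.snd, e.fst_r, e.snd_l⟩,
      e.fst.fst_r, e.fst.snd_l⟩, fun _ => rfl, fun _ => rfl⟩

section

variable (M : SpanFam V X Y A) (N : SpanFam V Y Z B) (Q : SpanFam V Z W C)
  {i : I} {j : J} {k : K} {l : L} (a : A.Elt i j) (b : B.Elt j k) (c : C.Elt k l)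
  (x : X i) (y : Y j) (z : Z k) (t : W l)

/-- The coprojections of the coproduct of a threefold composite of families of matrices. -/
noncomputable def prodInjL : hcomp (M a) (N b) x z ⊗ Q c z t ⟶
    sigmaPro (compFam (compFam M N) Q) ⟨i, x⟩ ⟨l, t⟩ :=
  compInj (compFam M N) Q (eltComp a b) c x z t

/-- The coprojections of the coproduct of a threefold composite of families of matrices. -/
noncomputable def prodInjR : M a x y ⊗ hcomp (N b) (Q c) y t ⟶
    sigmaPro (compFam M (compFam N Q)) ⟨i, x⟩ ⟨l, t⟩ :=
  compInj M (compFam N Q) a (eltComp b c) x y t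

/-- An instance of `compInj_sigmaCompCell` in which the inner composite is displayed as `hcomp (M a)
(N b)`, so that its coprojections can be whiskered and rewritten. -/
lemma prodInjL_sigmaCompCell :
    prodInjL M N Q a b c x z t ≫ sigmaCompCell (compFam M N) Q ⟨i, x⟩ ⟨l, t⟩ =
      (prodInj M N a b x z ⊗ₘ sigmaInj Q c z t) ≫
        inj (sigmaPro (compFam M N)) (sigmaPro Q) ⟨i, x⟩ ⟨k, z⟩ ⟨l, t⟩ :=
  compInj_sigmaCompCell (compFam M N) Q (eltComp a b) c x z t

lemma prodInjR_sigmaCompCell :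
    prodInjR M N Q a b c x y t ≫ sigmaCompCell M (compFam N Q) ⟨i, x⟩ ⟨l, t⟩ =
      (sigmaInj M a x y ⊗ₘ prodInj N Q b c y t) ≫
        inj (sigmaPro M) (sigmaPro (compFam N Q)) ⟨i, x⟩ ⟨j, y⟩ ⟨l, t⟩ :=
  compInj_sigmaCompCell M (compFam N Q) a (eltComp b c) x y t

/-- The coprojections of the coproduct of a threefold composite of families of matrices. -/
noncomputable def compInjL : (M a x y ⊗ N b y z) ⊗ Q c z t ⟶
    sigmaPro (compFam (compFam M N) Q) ⟨i, x⟩ ⟨l, t⟩ :=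
  inj (M a) (N b) x y z ▷ Q c z t ≫ prodInjL M N Q a b c x z t

/-- The coprojections of the coproduct of a threefold composite of families of matrices. -/
noncomputable def compInjR : M a x y ⊗ N b y z ⊗ Q c z t ⟶
    sigmaPro (compFam M (compFam N Q)) ⟨i, x⟩ ⟨l, t⟩ :=
  M a x y ◁ inj (N b) (Q c) y z t ≫ prodInjR M N Q a b c x y t

variable {M N Q x t} in
-- `compFam_ext` leaves a tensor product whose left factor is itself a coproduct over `y`;
-- distributivity in that factor finishes the reduction to threefold tensor products.
lemma compFam_compFam_ext {T : V} {r s : sigmaPro (compFam (compFam M N) Q) ⟨i, x⟩ ⟨l, t⟩ ⟶ T}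
    (h : ∀ (j : J) (k : K) (a : A.Elt i j) (b : B.Elt j k) (c : C.Elt k l) (y : Y j) (z : Z k),
      compInjL M N Q a b c x y z t ≫ r = compInjL M N Q a b c x y z t ≫ s) : r = s := by
  refine compFam_ext fun k e c z => eltComp_cases (P := fun e =>
    compInj (compFam M N) Q e c x z t ≫ r = compInj (compFam M N) Q e c x z t ≫ s)
    (fun j a b => hcompR_ext fun y => ?_) e
  have := h j k a b c y z
  rw [compInjL, Category.assoc, Category.assoc] at this
  exact this

/-- The associator of families regroups `((a, b), c)` as `(a, (b, c))`, so on generators it is the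
associator of `V`. -/
lemma compInjL_sigmaCell_assocMap :
    compInjL M N Q a b c x y z t ≫
        sigmaCell (F := fun _ x => x) (G := fun _ t => t) (M := compFam (compFam M N) Q)
          (M' := compFam M (compFam N Q)) (assocMap A B C)
          (fun _ _ e => assoc (M e.fst.fst) (N e.fst.snd) (Q e.snd)) ⟨i, x⟩ ⟨l, t⟩ =
      (α_ _ _ _).hom ≫ compInjR M N Q a b c x y z t := by
  rw [compInjL, Category.assoc]
  refine (congrArg (inj _ _ x y z ▷ _ ≫ ·) ((Category.assoc _ _ _).trans
    (congrArg (inj (hcomp (M a) (N b)) (Q c) x z t ≫ ·)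
      (sigmaInj_cell _ _ (eltComp (eltComp a b) c) x t)))).trans ?_
  exact inj_assoc _ _ _ _ _ _ _ _

lemma compInjL_sigmaCompCell :
    compInjL M N Q a b c x y z t ≫ sigmaCompCell (compFam M N) Q ⟨i, x⟩ ⟨l, t⟩ =
      (compInj M N a b x y z ⊗ₘ sigmaInj Q c z t) ≫
        inj (sigmaPro (compFam M N)) (sigmaPro Q) ⟨i, x⟩ ⟨k, z⟩ ⟨l, t⟩ := by
  rw [compInjL, Category.assoc, prodInjL_sigmaCompCell,
    MonoidalCategory.whiskerRight_comp_tensorHom_assoc, inj_prodInj]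

lemma compInjR_sigmaCompCell :
    compInjR M N Q a b c x y z t ≫ sigmaCompCell M (compFam N Q) ⟨i, x⟩ ⟨l, t⟩ =
      (sigmaInj M a x y ⊗ₘ compInj N Q b c y z t) ≫
        inj (sigmaPro M) (sigmaPro (compFam N Q)) ⟨i, x⟩ ⟨j, y⟩ ⟨l, t⟩ := by
  rw [compInjR, Category.assoc, prodInjR_sigmaCompCell,
    MonoidalCategory.whiskerLeft_comp_tensorHom_assoc, inj_prodInj]

end

/-- On the generator at `(a, b, c, y, z)` the two sides differ by moving the associator of `V` past
the tensor of the three coprojections, which is its naturality. -/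
lemma sigmaCompCell_assoc (M : SpanFam V X Y A) (N : SpanFam V Y Z B) (Q : SpanFam V Z W C)
    (p : Σ i, X i) (s : Σ l, W l) :
    sigmaCompCell (compFam M N) Q p s ≫
        hcompCell (f := fun p => p) (g := fun r => r) (h := fun s => s)
          (sigmaCompCell M N) (fun r s => 𝟙 (sigmaPro Q r s)) p s ≫
        assoc (sigmaPro M) (sigmaPro N) (sigmaPro Q) p s =
      sigmaCell (F := fun _ x => x) (G := fun _ t => t) (M := compFam (compFam M N) Q)
          (M' := compFam M (compFam N Q)) (assocMap A B C)
          (fun _ _ e => assoc (M e.fst.fst) (N e.fst.snd) (Q e.snd)) p s ≫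
        sigmaCompCell M (compFam N Q) p s ≫
        hcompCell (f := fun p => p) (g := fun q => q) (h := fun s => s)
          (fun p q => 𝟙 (sigmaPro M p q)) (sigmaCompCell N Q) p s := by
  obtain ⟨i, x⟩ := p
  obtain ⟨l, t⟩ := s
  refine compFam_compFam_ext fun j k a b c y z => ?_
  rw [← Category.assoc, compInjL_sigmaCompCell, ← Category.assoc (compInjL _ _ _ _ _ _ _ _ _ _),
    compInjL_sigmaCell_assocMap, Category.assoc, Category.assoc, inj_hcompCell_assoc,
    ← Category.assoc (compInjR _ _ _ _ _ _ _ _ _ _), compInjR_sigmaCompCell, Category.assoc,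
    inj_hcompCell, MonoidalCategory.tensorHom_comp_tensorHom_assoc,
    MonoidalCategory.tensorHom_comp_tensorHom_assoc, compInj_sigmaCompCell, compInj_sigmaCompCell,
    Category.comp_id, Category.comp_id, ← MonoidalCategory.tensorHom_comp_whiskerRight,
    ← MonoidalCategory.tensorHom_comp_whiskerLeft, Category.assoc, Category.assoc, inj_assoc',
    MonoidalCategory.associator_naturality_assoc]

end Sigma

/-! ### Comparison of the coproduct with identities -/

section SigmaId

variable {V : Type u} [Category.{v} V] [MonoidalCategory V] [DistributiveMonoidal.{w} V]
  {I J : Type w} {X : I → Type w} {Y : J → Type w} {A : SetSpan I J}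

variable (V X) in
/-- The family of identity matrices, indexed by the identity span. -/
noncomputable abbrev idFam : SpanFam V X X (SetSpan.idSpan I) :=
  fun _ _ a => DblFam.idPro (D := VMat.{w} V) ⟨I, X⟩ (a.2.1.symm.trans a.2.2)

/-- The elements of the identity span. -/
abbrev idElt (i : I) : (SetSpan.idSpan I).Elt i i := ⟨i, rfl, rfl⟩

variable (V) in
/-- The coprojections of the coproduct of a family of identity matrices. -/
noncomputable def hidInj (i : I) (x x' : X i) :
    hid (V := V) (X i) x x' ⟶ sigmaPro (idFam V X) ⟨i, x⟩ ⟨i, x'⟩ :=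
  sigmaInj (idFam V X) (idElt i) x x'

variable (V) in
/-- The coprojections of the coproduct of a family of identity matrices. -/
noncomputable def idInj (i : I) (x : X i) : 𝟙_ V ⟶ sigmaPro (idFam V X) ⟨i, x⟩ ⟨i, x⟩ :=
  unitInj rfl ≫ hidInj V i x x

/-- An element of the identity span over `(i, j)` forces `i = j`, and a summand of an identity
matrix forces `x = x'`, so only the diagonal carries generators. The maps are taken as families over
all pairs so that these equalities can be substituted. -/
lemma idFam_ext {T : (p p' : Σ i, X i) → V} {s t : ∀ p p', sigmaPro (idFam V X) p p' ⟶ T p p'}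
    (h : ∀ i x, idInj V i x ≫ s ⟨i, x⟩ ⟨i, x⟩ = idInj V i x ≫ t ⟨i, x⟩ ⟨i, x⟩)
    (p p' : Σ i, X i) : s p p' = t p p' := by
  obtain ⟨i, x⟩ := p
  obtain ⟨j, x'⟩ := p'
  refine sigma_ext fun a => ?_
  obtain ⟨k, h₁, h₂⟩ := a
  change k = i at h₁
  change k = j at h₂
  subst h₁ h₂
  refine unit_ext fun e => ?_
  subst e
  exact (Category.assoc _ _ _).symm.trans ((h k x).trans (Category.assoc _ _ _))

/-- Morphisms out of a member of a family of identity matrices. -/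
noncomputable def idFamDesc {T : V} {i j : I} (h : i = j) {x : X i} {x' : X j}
    (φ : (⟨i, x⟩ : Σ i, X i) = ⟨j, x'⟩ → (𝟙_ V ⟶ T)) :
    DblFam.idPro (D := VMat.{w} V) ⟨I, X⟩ h x x' ⟶ T := by
  subst h
  exact unitDesc fun e => φ (by rw [e])

variable (V) in
/-- The comparison of the coproduct of identity matrices with an identity matrix. -/
noncomputable def sigmaIdCell (p p' : Σ i, X i) :
    sigmaPro (idFam V X) p p' ⟶ hid (Σ i, X i) p p' :=
  sigmaDesc fun _ => idFamDesc _ fun e => unitInj e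

variable (V) in
lemma idInj_sigmaIdCell (i : I) (x : X i) :
    idInj V i x ≫ sigmaIdCell V ⟨i, x⟩ ⟨i, x⟩ = unitInj rfl := by
  rw [idInj, Category.assoc]
  refine (congrArg (unitInj rfl ≫ ·) (sigmaInj_desc _ (idElt i))).trans ?_
  exact unitInj_desc (V := V) (x := x) (x' := x)
    (fun e => unitInj (congrArg (Sigma.mk i) e)) rfl

variable (V) in
lemma idInj_sigmaIdCell_assoc (i : I) (x : X i) {T : V} (t : hid (Σ i, X i) ⟨i, x⟩ ⟨i, x⟩ ⟶ T) :
    idInj V i x ≫ sigmaIdCell V ⟨i, x⟩ ⟨i, x⟩ ≫ t = unitInj rfl ≫ t := by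
  rw [← Category.assoc, idInj_sigmaIdCell]

variable (V) in
/-- The inverse of `sigmaIdCell`. -/
noncomputable def sigmaIdInv (p p' : Σ i, X i) :
    hid (V := V) (Σ i, X i) p p' ⟶ sigmaPro (idFam V X) p p' :=
  unitDesc fun e => idInj V p.1 p.2 ≫ eqToHom (by rw [e])

lemma unitInj_sigmaIdInv (p : Σ i, X i) :
    unitInj (V := V) rfl ≫ sigmaIdInv V p p = idInj V p.1 p.2 := by
  rw [sigmaIdInv, unitInj_desc, eqToHom_refl, Category.comp_id]

lemma sigmaIdCell_inv (p p' : Σ i, X i) : sigmaIdCell V p p' ≫ sigmaIdInv V p p' = 𝟙 _ := by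
  refine idFam_ext (s := fun p p' => sigmaIdCell V p p' ≫ sigmaIdInv V p p') (t := fun _ _ => 𝟙 _)
    (fun i x => ?_) p p'
  rw [idInj_sigmaIdCell_assoc, unitInj_sigmaIdInv, Category.comp_id]

lemma sigmaIdInv_cell (p p' : Σ i, X i) : sigmaIdInv V p p' ≫ sigmaIdCell V p p' = 𝟙 _ := by
  refine unit_ext fun e => ?_
  subst e
  rw [← Category.assoc, unitInj_sigmaIdInv, idInj_sigmaIdCell, Category.comp_id]

/-- The map of identity spans induced by a function. -/
abbrev idMap {I' : Type w} (f : I → I') :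
    SetSpan.Map f f (SetSpan.idSpan I) (SetSpan.idSpan I') :=
  ⟨f, fun _ => rfl, fun _ => rfl⟩

/-- The cells `α` are pinned down only at the elements `idElt i`. This suffices because the
generators lie there, and it avoids computing with identity cells transported along equalities of
indices. -/
lemma sigmaIdCell_naturality {I' : Type w} {X' : I' → Type w} {f : I → I'}
    {F : ∀ i, X i → X' (f i)}
    (α : ∀ ⦃i j⦄ (a : (SetSpan.idSpan I).Elt i j),
      Cell (F i) (F j) (idFam V X a) (idFam V X' ((idMap f).elt a)))
    (hα : ∀ i, α (idElt i) = hidCell (F i)) (p p' : Σ i, X i) :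
    sigmaCell (F := F) (G := F) (idMap f) α p p' ≫ sigmaIdCell V (sigmaMap f F p) (sigmaMap f F p') =
      sigmaIdCell V p p' ≫ hidCell (sigmaMap f F) p p' := by
  refine idFam_ext (s := fun p p' => sigmaCell (F := F) (G := F) (idMap f) α p p' ≫ sigmaIdCell V _ _)
    (t := fun p p' => sigmaIdCell V p p' ≫ hidCell (sigmaMap f F) p p') (fun i x => ?_) p p'
  rw [idInj_sigmaIdCell_assoc, unitInj_hidCell]
  refine Eq.trans ?_ (idInj_sigmaIdCell V (f i) (F i x))
  rw [← Category.assoc]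
  congr 1
  rw [idInj, Category.assoc]
  refine (congrArg (unitInj rfl ≫ ·) (sigmaInj_cell _ _ (idElt i) x x)).trans ?_
  rw [hα]
  exact (Category.assoc _ _ _).symm.trans
    (congrArg (· ≫ hidInj V (f i) (F i x) (F i x)) (unitInj_hidCell _ rfl))

/-! ### Compatibility of the comparisons with unitors -/

section

variable (M : SpanFam V X Y A) {i : I} {j : J} (a : A.Elt i j) (x : X i) (y : Y j)

/-- The coprojections of the coproduct of a composite with identity matrices. -/
noncomputable def idCompInj : 𝟙_ V ⊗ M a x y ⟶ sigmaPro (compFam (idFam V X) M) ⟨i, x⟩ ⟨j, y⟩ :=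
  unitInj rfl ▷ M a x y ≫ inj (hid (X i)) (M a) x x y ≫ prodInj (idFam V X) M (idElt i) a x y

/-- The coprojections of the coproduct of a composite with identity matrices. -/
noncomputable def compIdInj : M a x y ⊗ 𝟙_ V ⟶ sigmaPro (compFam M (idFam V Y)) ⟨i, x⟩ ⟨j, y⟩ :=
  M a x y ◁ unitInj rfl ≫ inj (M a) (hid (Y j)) x y y ≫ prodInj M (idFam V Y) a (idElt j) x y

variable {M x y} in
-- In the composite with the identity span, the first component of an element is determined by the
-- second; distributivity then reduces the left tensor factor to the unit.
lemma idComp_ext {T : V} {s t : sigmaPro (compFam (idFam V X) M) ⟨i, x⟩ ⟨j, y⟩ ⟶ T}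
    (h : ∀ a : A.Elt i j, idCompInj M a x y ≫ s = idCompInj M a x y ≫ t) : s = t := by
  refine compFam_ext fun k b a x' => ?_
  obtain ⟨l, h₁, h₂⟩ := b
  change l = i at h₁
  change l = k at h₂
  subst h₁ h₂
  refine unitR_ext fun e => ?_
  subst e
  exact (Category.assoc _ _ _).symm.trans ((h a).trans (Category.assoc _ _ _))

variable {M x y} in
lemma compId_ext {T : V} {s t : sigmaPro (compFam M (idFam V Y)) ⟨i, x⟩ ⟨j, y⟩ ⟶ T}
    (h : ∀ a : A.Elt i j, compIdInj M a x y ≫ s = compIdInj M a x y ≫ t) : s = t := by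
  refine compFam_ext fun k a b y' => ?_
  obtain ⟨l, h₁, h₂⟩ := b
  change l = k at h₁
  change l = j at h₂
  subst h₁ h₂
  refine unitL_ext fun e => ?_
  subst e
  exact (Category.assoc _ _ _).symm.trans ((h a).trans (Category.assoc _ _ _))

lemma idCompInj_sigmaCompCell :
    idCompInj M a x y ≫ sigmaCompCell (idFam V X) M ⟨i, x⟩ ⟨j, y⟩ =
      (idInj V i x ⊗ₘ sigmaInj M a x y) ≫
        inj (sigmaPro (idFam V X)) (sigmaPro M) ⟨i, x⟩ ⟨i, x⟩ ⟨j, y⟩ := by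
  -- The transport inside `idFam` is trivial at `idElt i`, so the general formula holds verbatim
  -- with `hid (X i)` in place of the transported matrix, and `unitInj` can be composed with it.
  have h : (inj (hid (X i)) (M a) x x y ≫ prodInj (idFam V X) M (idElt i) a x y) ≫
      sigmaCompCell (idFam V X) M ⟨i, x⟩ ⟨j, y⟩ = (hidInj V i x x ⊗ₘ sigmaInj M a x y) ≫
        inj (sigmaPro (idFam V X)) (sigmaPro M) ⟨i, x⟩ ⟨i, x⟩ ⟨j, y⟩ :=
    compInj_sigmaCompCell (idFam V X) M (idElt i) a x x y
  rw [idCompInj, Category.assoc]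
  refine (congrArg (unitInj rfl ▷ M a x y ≫ ·) h).trans ?_
  rw [MonoidalCategory.whiskerRight_comp_tensorHom_assoc, idInj]

lemma compIdInj_sigmaCompCell :
    compIdInj M a x y ≫ sigmaCompCell M (idFam V Y) ⟨i, x⟩ ⟨j, y⟩ =
      (sigmaInj M a x y ⊗ₘ idInj V j y) ≫
        inj (sigmaPro M) (sigmaPro (idFam V Y)) ⟨i, x⟩ ⟨j, y⟩ ⟨j, y⟩ := by
  have h : (inj (M a) (hid (Y j)) x y y ≫ prodInj M (idFam V Y) a (idElt j) x y) ≫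
      sigmaCompCell M (idFam V Y) ⟨i, x⟩ ⟨j, y⟩ = (sigmaInj M a x y ⊗ₘ hidInj V j y y) ≫
        inj (sigmaPro M) (sigmaPro (idFam V Y)) ⟨i, x⟩ ⟨j, y⟩ ⟨j, y⟩ :=
    compInj_sigmaCompCell M (idFam V Y) a (idElt j) x y y
  rw [compIdInj, Category.assoc]
  refine (congrArg (M a x y ◁ unitInj rfl ≫ ·) h).trans ?_
  rw [MonoidalCategory.whiskerLeft_comp_tensorHom_assoc, idInj]

end

/-- The left unitor map of spans. -/
abbrev lunitMap (A : SetSpan I J) :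
    SetSpan.Map (fun i => i) (fun j => j) ((SetSpan.idSpan I).comp A) A :=
  ⟨fun e => e.snd, fun e => e.snd_l.trans e.fst_r.symm, fun _ => rfl⟩

/-- The right unitor map of spans. -/
abbrev runitMap (A : SetSpan I J) :
    SetSpan.Map (fun i => i) (fun j => j) (A.comp (SetSpan.idSpan J)) A :=
  ⟨fun e => e.fst, fun _ => rfl, fun e => e.fst_r.trans e.snd_l.symm⟩

/-- On generators, both sides are the left unitor of `V` followed by the coprojection at `a`. As for
identity cells, `α` is prescribed only at composites with `idElt i`, where the unitor of families
needs no transport. -/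
lemma sigmaCompCell_lunit (M : SpanFam V X Y A)
    (α : ∀ ⦃i j⦄ (e : ((SetSpan.idSpan I).comp A).Elt i j),
      Cell (fun x => x) (fun y => y) (compFam (idFam V X) M e) (M ((lunitMap A).elt e)))
    (hα : ∀ ⦃i j⦄ (a : A.Elt i j), α (eltComp (idElt i) a) = lunit (M a))
    (p : Σ i, X i) (q : Σ j, Y j) :
    sigmaCompCell (idFam V X) M p q ≫
        hcompCell (f := fun p => p) (g := fun p => p) (h := fun q => q)
          (sigmaIdCell V) (fun p q => 𝟙 (sigmaPro M p q)) p q ≫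
        lunit (sigmaPro M) p q =
      sigmaCell (F := fun _ x => x) (G := fun _ y => y) (lunitMap A) α p q := by
  obtain ⟨i, x⟩ := p
  obtain ⟨j, y⟩ := q
  refine idComp_ext fun a => ?_
  rw [← Category.assoc, idCompInj_sigmaCompCell, Category.assoc, inj_hcompCell_assoc,
    MonoidalCategory.tensorHom_comp_tensorHom_assoc, idInj_sigmaIdCell, Category.comp_id,
    MonoidalCategory.tensorHom_def', Category.assoc, inj_lunit', leftUnitor_naturality, idCompInj,
    Category.assoc]
  refine Eq.trans ?_ (congrArg (unitInj rfl ▷ M a x y ≫ ·) ((Category.assoc _ _ _).trans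
    (congrArg (inj (hid (X i)) (M a) x x y ≫ ·)
      (sigmaInj_cell (lunitMap A) α (eltComp (idElt i) a) x y)))).symm
  rw [hα]
  exact (inj_lunit _ _ _ _).symm

lemma sigmaCompCell_runit (M : SpanFam V X Y A)
    (α : ∀ ⦃i j⦄ (e : (A.comp (SetSpan.idSpan J)).Elt i j),
      Cell (fun x => x) (fun y => y) (compFam M (idFam V Y) e) (M ((runitMap A).elt e)))
    (hα : ∀ ⦃i j⦄ (a : A.Elt i j), α (eltComp a (idElt j)) = runit (M a))
    (p : Σ i, X i) (q : Σ j, Y j) :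
    sigmaCompCell M (idFam V Y) p q ≫
        hcompCell (f := fun p => p) (g := fun q => q) (h := fun q => q)
          (fun p q => 𝟙 (sigmaPro M p q)) (sigmaIdCell V) p q ≫
        runit (sigmaPro M) p q =
      sigmaCell (F := fun _ x => x) (G := fun _ y => y) (runitMap A) α p q := by
  obtain ⟨i, x⟩ := p
  obtain ⟨j, y⟩ := q
  refine compId_ext fun a => ?_
  rw [← Category.assoc, compIdInj_sigmaCompCell, Category.assoc, inj_hcompCell_assoc,
    MonoidalCategory.tensorHom_comp_tensorHom_assoc, idInj_sigmaIdCell, Category.comp_id,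
    MonoidalCategory.tensorHom_def, Category.assoc, inj_runit', rightUnitor_naturality, compIdInj,
    Category.assoc]
  refine Eq.trans ?_ (congrArg (M a x y ◁ unitInj rfl ≫ ·) ((Category.assoc _ _ _).trans
    (congrArg (inj (M a) (hid (Y j)) x y y ≫ ·)
      (sigmaInj_cell (runitMap A) α (eltComp a (idElt j)) x y)))).symm
  rw [hα]
  exact (inj_runit _ _ _ _).symm

end SigmaId

/-! ### The double functor `sigma` and its adjunction with singleton families -/

section SigmaFunctor

variable {V : Type u} [Category.{v} V] [MonoidalCategory V] [DistributiveMonoidal.{w} V]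

/-- The members of a family of proarrows of `VMat V`, as a family of matrices. -/
abbrev famPro {X Y : FamObj.{w} (VMat.{w} V)} (M : FamPro X Y) :
    SpanFam V (fun i => Carrier (X.obj i)) (fun j => Carrier (Y.obj j)) M.span :=
  fun _ _ a => M.pro a

/-- The coproduct of a family of cells of matrices. -/
noncomputable def sigmaFamCell {X X' Y Y' : FamObj.{w} (VMat.{w} V)} {f : X ⟶ X'} {g : Y ⟶ Y'}
    {M : FamPro X Y} {N : FamPro X' Y'} (α : FamCell f g M N) :
    Cell (sigmaMap f.ind fun i => fn (f.arr i)) (sigmaMap g.ind fun j => fn (g.arr j))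
      (sigmaPro (famPro M)) (sigmaPro (famPro N)) :=
  sigmaCell (M := famPro M) (M' := famPro N) α.ind fun _ _ a => α.cell a

/-- Restricting a composite of cells to one composable pair `(a, b)` gives the composite of the
restrictions. Applied to singleton families, it shows that the counit respects composition. -/
lemma prodInj_sigmaCompCell_hcompCell {I J K : Type w} {X : I → Type w} {Y : J → Type w}
    {Z : K → Type w} {A : SetSpan I J} {B : SetSpan J K} {X' Y' Z' : Type w}
    {f : (Σ i, X i) → X'} {g : (Σ j, Y j) → Y'} {h : (Σ k, Z k) → Z'}
    {M' : X' → Y' → V} {N' : Y' → Z' → V}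
    (M : SpanFam V X Y A) (N : SpanFam V Y Z B) {i : I} {j : J}
    {k : K} (a : A.Elt i j) (b : B.Elt j k) (x : X i) (z : Z k)
    (α : Cell f g (sigmaPro M) M') (β : Cell g h (sigmaPro N) N') :
    prodInj M N a b x z ≫ sigmaCompCell M N ⟨i, x⟩ ⟨k, z⟩ ≫ hcompCell α β ⟨i, x⟩ ⟨k, z⟩ =
      hcompCell (f := fun x => f ⟨i, x⟩) (g := fun y => g ⟨j, y⟩) (h := fun z => h ⟨k, z⟩)
        (fun x y => sigmaInj M a x y ≫ α ⟨i, x⟩ ⟨j, y⟩)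
        (fun y z => sigmaInj N b y z ≫ β ⟨j, y⟩ ⟨k, z⟩) x z := by
  refine hcomp_ext fun y => ?_
  rw [inj_hcompCell, ← Category.assoc, inj_prodInj, compInj_sigmaCompCell_assoc, inj_hcompCell,
    MonoidalCategory.tensorHom_comp_tensorHom_assoc]

/-- The nullary analogue of `prodInj_sigmaCompCell_hcompCell`, for the compatibility of the counit
with identities. -/
lemma hidInj_sigmaIdCell_hidCell {I : Type w} {X : I → Type w} {X' : Type w}
    (f : (Σ i, X i) → X') (i : I) (x x' : X i) :
    hidInj V i x x' ≫ sigmaIdCell V ⟨i, x⟩ ⟨i, x'⟩ ≫ hidCell f ⟨i, x⟩ ⟨i, x'⟩ =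
      hidCell (fun x => f ⟨i, x⟩) x x' := by
  refine unit_ext fun e => ?_
  subst e
  rw [unitInj_hidCell, ← Category.assoc]
  refine (idInj_sigmaIdCell_assoc V i x _).trans ?_
  rw [unitInj_hidCell]

/-- The family with one member, indexed by the span between one-element sets. -/
abbrev singletonFam {X Y : Type w} (M : X → Y → V) :
    SpanFam V (fun _ : PUnit.{w + 1} => X) (fun _ : PUnit.{w + 1} => Y)
      ⟨PUnit, fun a => a, fun a => a⟩ :=
  fun _ _ _ => M

/-- The projection from the coproduct of a one-member family. -/
noncomputable def singletonDesc {X Y : Type w} (M : X → Y → V) :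
    Cell Sigma.snd Sigma.snd (sigmaPro (singletonFam M)) M :=
  fun p q => sigmaDesc fun _ => 𝟙 (M p.2 q.2)

lemma sigmaInj_singletonDesc {X Y : Type w} (M : X → Y → V) {i j : PUnit.{w + 1}}
    (a : SetSpan.Elt ⟨PUnit, fun a => a, fun a => a⟩ i j) (x : X) (y : Y) :
    sigmaInj (singletonFam M) a x y ≫ singletonDesc M ⟨i, x⟩ ⟨j, y⟩ = 𝟙 (M x y) :=
  sigmaInj_desc _ _

lemma sigmaInj_singletonDesc_assoc {X Y : Type w} (M : X → Y → V) {i j : PUnit.{w + 1}}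
    (a : SetSpan.Elt ⟨PUnit, fun a => a, fun a => a⟩ i j) (x : X) (y : Y) {T : V} (t : M x y ⟶ T) :
    sigmaInj (singletonFam M) a x y ≫ singletonDesc M ⟨i, x⟩ ⟨j, y⟩ ≫ t = t := by
  rw [← Category.assoc, sigmaInj_singletonDesc, Category.id_comp]

lemma hcompCell_singletonDesc {X Y Z : Type w} (M : X → Y → V) (N : Y → Z → V)
    {i j k : PUnit.{w + 1}} (a : SetSpan.Elt ⟨PUnit, fun a => a, fun a => a⟩ i j)
    (b : SetSpan.Elt ⟨PUnit, fun a => a, fun a => a⟩ j k) (x : X) (z : Z) :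
    hcompCell (f := fun x => x) (g := fun y => y) (h := fun z => z)
      (fun x y => sigmaInj (singletonFam M) a x y ≫ singletonDesc M ⟨i, x⟩ ⟨j, y⟩)
      (fun y z => sigmaInj (singletonFam N) b y z ≫ singletonDesc N ⟨j, y⟩ ⟨k, z⟩) x z =
      𝟙 (hcomp M N x z) := by
  simp only [sigmaInj_singletonDesc]
  exact congrFun (congrFun (hcompCell_vid M N) x) z

/-- The content of the compatibility of the unit with composition; `hidCell_sigmaMk` plays the same
role for identities. -/
lemma hcompCell_sigmaInj {I J K : Type w} {X : I → Type w} {Y : J → Type w} {Z : K → Type w}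
    {A : SetSpan I J} {B : SetSpan J K} (M : SpanFam V X Y A) (N : SpanFam V Y Z B) {i : I} {j : J}
    {k : K} (a : A.Elt i j) (b : B.Elt j k) (x : X i) (z : Z k) :
    hcompCell (f := Sigma.mk i) (g := Sigma.mk j) (h := Sigma.mk k) (sigmaInj M a) (sigmaInj N b)
        x z =
      prodInj M N a b x z ≫ sigmaCompCell M N ⟨i, x⟩ ⟨k, z⟩ := by
  refine hcomp_ext fun y => ?_
  rw [inj_hcompCell, ← Category.assoc, inj_prodInj, compInj_sigmaCompCell]

lemma hidCell_sigmaMk {I : Type w} {X : I → Type w} (i : I) (x x' : X i) :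
    hidCell (V := V) (Sigma.mk (β := X) i) x x' =
      hidInj V i x x' ≫ sigmaIdCell V ⟨i, x⟩ ⟨i, x'⟩ := by
  refine unit_ext fun e => ?_
  subst e
  rw [unitInj_hidCell, ← Category.assoc]
  exact (idInj_sigmaIdCell V i x).symm

lemma sigmaFamCell_vid {X Y : FamObj.{w} (VMat.{w} V)} (M : FamPro X Y)
    (p : Σ i, Carrier (X.obj i)) (q : Σ j, Carrier (Y.obj j)) :
    sigmaFamCell ((DblFam.{w} (VMat.{w} V)).vid M) p q = 𝟙 (sigmaPro (famPro M) p q) := by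
  obtain ⟨i, x⟩ := p
  obtain ⟨j, y⟩ := q
  refine sigma_ext fun a => (sigmaInj_cell _ _ a x y).trans
    ((Category.id_comp _).trans (Category.comp_id _).symm)

lemma sigmaFamCell_vcomp {X X' X'' Y Y' Y'' : FamObj.{w} (VMat.{w} V)} {f : X ⟶ X'} {f' : X' ⟶ X''}
    {g : Y ⟶ Y'} {g' : Y' ⟶ Y''} {M : FamPro X Y} {M' : FamPro X' Y'} {M'' : FamPro X'' Y''}
    (α : FamCell f g M M') (β : FamCell f' g' M' M'')
    (p : Σ i, Carrier (X.obj i)) (q : Σ j, Carrier (Y.obj j)) :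
    sigmaFamCell ((DblFam.{w} (VMat.{w} V)).vcomp α β) p q =
      sigmaFamCell α p q ≫ sigmaFamCell β (sigmaMap f.ind (fun i => fn (f.arr i)) p)
        (sigmaMap g.ind (fun j => fn (g.arr j)) q) := by
  obtain ⟨i, x⟩ := p
  obtain ⟨j, y⟩ := q
  refine sigma_ext fun a => (sigmaInj_cell _ _ a x y).trans (Eq.trans ?_
    (sigmaInj_cell_assoc α.ind (fun _ _ a => α.cell a) a x y _).symm)
  refine (Category.assoc _ _ _).trans (congrArg (α.cell a x y ≫ ·) ?_)
  exact (sigmaInj_cell β.ind (fun _ _ a => β.cell a) (α.ind.elt a) _ _).symm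

variable (V) in
/-- The functor sending a family of sets to its disjoint union. -/
def sigmaBase : FamObj.{w} (VMat.{w} V) ⥤ (VMat.{w} V).Obj where
  obj X := (Σ i, Carrier (X.obj i) : Type w)
  map f := (TypeCat.ofHom (sigmaMap f.ind fun i => fn (f.arr i)) : _ ⟶ _)
  map_id _ := rfl
  map_comp _ _ := rfl

variable (V) in
/-- The double functor sending a family of matrices to its coproduct. -/
noncomputable def sigma : ColaxFunctor (DblFam.{w} (VMat.{w} V)) (VMat.{w} V) where
  base := sigmaBase V
  pro M := sigmaPro (famPro M)
  cell α := sigmaFamCell α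
  compCell M N := sigmaCompCell (famPro M) (famPro N)
  idCell X := sigmaIdCell (X := fun i => Carrier (X.obj i)) V
  -- Arrows of `VMat V` are functions, whose identity and composition laws hold definitionally. The
  -- two cells in each axiom therefore have the same boundary type, and the `HEq` can be proved
  -- entrywise as an equality.
  cell_vid M := heq_of_eq (by
    funext p q
    exact sigmaFamCell_vid M p q)
  cell_vcomp α β := heq_of_eq (by
    funext p q
    exact sigmaFamCell_vcomp α β p q)
  compCell_naturality α β := heq_of_eq (by
    funext p r
    exact sigmaCompCell_naturality α.ind β.ind (fun _ _ a => α.cell a) (fun _ _ b => β.cell b) p r)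
  -- The condition on diagonal elements is `rfl` because `DblFam.hidCellAux` reduces to `hidCell`
  -- when the two indices coincide; the unitors below behave in the same way.
  idCell_naturality f := heq_of_eq (by
    funext p p'
    exact sigmaIdCell_naturality _ (fun _ => rfl) p p')
  compCell_assoc M N Q := heq_of_eq (by
    funext p s
    exact sigmaCompCell_assoc (famPro M) (famPro N) (famPro Q) p s)
  compCell_lunit M := heq_of_eq (by
    funext p q
    exact sigmaCompCell_lunit (famPro M) _ (fun _ _ _ => rfl) p q)
  compCell_runit M := heq_of_eq (by
    funext p q
    exact sigmaCompCell_runit (famPro M) _ (fun _ _ _ => rfl) p q)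

variable (V) in
-- The entrywise inverses, packaged as cells with identity sides, invert the comparison cells in the
-- category of proarrows.
lemma sigma_isPseudo : (sigma.{w} V).IsPseudo := by
  refine ⟨fun M N => ⟨DblCat.hom (D := VMat.{w} V) (f := 𝟙 _) (g := 𝟙 _)
    (sigmaCompInv (famPro M) (famPro N)), ?_, ?_⟩,
    fun X => ⟨DblCat.hom (D := VMat.{w} V) (f := 𝟙 _) (g := 𝟙 _)
      (sigmaIdInv (X := fun i => Carrier (X.obj i)) V), ?_, ?_⟩⟩
  · refine DblCat.hom_congr rfl rfl (heq_of_eq ?_)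
    funext p r
    exact sigmaCompCell_inv (famPro M) (famPro N) p r
  · refine DblCat.hom_congr rfl rfl (heq_of_eq ?_)
    funext p r
    exact sigmaCompInv_cell (famPro M) (famPro N) p r
  · refine DblCat.hom_congr rfl rfl (heq_of_eq ?_)
    funext p p'
    exact sigmaIdCell_inv p p'
  · refine DblCat.hom_congr rfl rfl (heq_of_eq ?_)
    funext p p'
    exact sigmaIdInv_cell p p'

variable (V) in
/-- The unit of the adjunction between coproducts and singleton families. -/
noncomputable def sigmaUnit : ColaxTrans (ColaxFunctor.id (DblFam.{w} (VMat.{w} V)))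
    ((sigma.{w} V).comp (DblFam.singleton.{w} (VMat.{w} V))) where
  base :=
    { app := fun X => (⟨fun _ => PUnit.unit, fun i =>
        (TypeCat.ofHom (fun x => ⟨i, x⟩ : Carrier (X.obj i) → Σ i, Carrier (X.obj i)) : _ ⟶ _)⟩ :
          FamHom _ _)
      naturality := fun _ _ _ => rfl }
  cell M := ⟨⟨fun _ => PUnit.unit, fun _ => rfl, fun _ => rfl⟩,
    fun a x y => sigmaInj (famPro M) a x y⟩
  cell_naturality {_ _ _ _ _ _ M M'} α := DblFam.cell_heq rfl rfl (fun _ => rfl) fun a =>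
    heq_of_eq (by
      funext x y
      exact (sigmaInj_cell α.ind (fun _ _ a => α.cell a) ⟨a, rfl, rfl⟩ x y).symm)
  -- The comparison cells of the identity functor and of the singleton functor are identities,
  -- removed by `id_comp` and `comp_id`. What remains is `hcompCell_sigmaInj` at the two components
  -- of `e`.
  cell_hcomp {X Y Z} M N := DblFam.cell_heq rfl rfl (fun _ => rfl) fun e => heq_of_eq (by
    funext x z
    exact (Category.id_comp _).trans ((hcompCell_sigmaInj (famPro M) (famPro N)
      ⟨e.fst, rfl, e.fst_r⟩ ⟨e.snd, e.snd_l, rfl⟩ x z).trans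
        (congrArg (prodInj (famPro M) (famPro N) ⟨e.fst, rfl, e.fst_r⟩ ⟨e.snd, e.snd_l, rfl⟩ x z ≫ ·)
          (Category.comp_id _).symm)))
  cell_hid X := DblFam.cell_heq rfl rfl (fun _ => rfl) fun i => heq_of_eq (by
    funext x x'
    exact (Category.id_comp _).trans ((hidCell_sigmaMk i x x').trans
      (congrArg (hidInj V (X := fun i => Carrier (X.obj i)) i x x' ≫ ·)
        (Category.comp_id _).symm)))

variable (V) in
/-- The counit of the adjunction between coproducts and singleton families. -/
noncomputable def sigmaCounit :
    ColaxTrans ((DblFam.singleton.{w} (VMat.{w} V)).comp (sigma.{w} V))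
      (ColaxFunctor.id (VMat.{w} V)) where
  base :=
    { app := fun X => (TypeCat.ofHom (fun p => p.2 : (Σ _ : PUnit.{w + 1}, Carrier X) → Carrier X) :
        _ ⟶ _)
      naturality := fun _ _ _ => rfl }
  cell M := singletonDesc M
  cell_naturality {_ _ _ _ _ _ M M'} α := heq_of_eq (by
    funext ⟨i, x⟩ ⟨j, y⟩
    refine sigma_ext fun a => ?_
    refine (sigmaInj_cell_assoc _ _ a x y _).trans ?_
    refine (congrArg (α x y ≫ ·) (sigmaInj_desc _ _)).trans
      ((Category.comp_id _).trans ?_)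
    exact ((sigmaInj_singletonDesc_assoc M a x y (α x y))).symm)
  cell_hcomp {X Y Z} M N := heq_of_eq (by
    funext ⟨i, x⟩ ⟨k, z⟩
    refine sigma_ext fun a => ?_
    -- The comparison cell of the composite functor has two factors. The first is the coproduct of a
    -- family of identity cells, hence invisible on coprojections; the second is `sigmaCompCell`.
    refine (congrArg (sigmaInj _ a x z ≫ ·) (Category.assoc _ _ _)).trans ?_
    refine (sigmaInj_cell_assoc _ _ a x z _).trans ((Category.id_comp _).trans ?_)
    refine (prodInj_sigmaCompCell_hcompCell _ _ a a x z _ _).trans ?_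
    exact (hcompCell_singletonDesc M N a a x z).trans
      (sigmaInj_singletonDesc_assoc (hcomp M N) a x z (𝟙 _)).symm)
  cell_hid X := heq_of_eq (by
    funext ⟨i, x⟩ ⟨j, x'⟩
    refine sigma_ext fun a => ?_
    refine (congrArg (sigmaInj _ a x x' ≫ ·) (Category.assoc _ _ _)).trans ?_
    refine (sigmaInj_cell_assoc _ _ a x x' _).trans ((Category.id_comp _).trans ?_)
    refine (hidInj_sigmaIdCell_hidCell Sigma.snd PUnit.unit x x').trans ?_
    exact (congrFun (congrFun (hidCell_id X) x) x').trans
      (sigmaInj_singletonDesc_assoc (hid X) a x x' (𝟙 _)).symm)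

variable (V) in
/-- Coproducts are left adjoint to singleton families. -/
noncomputable def sigmaAdjunction :
    ColaxAdjunction (sigma.{w} V) (DblFam.singleton.{w} (VMat.{w} V)) where
  unit := sigmaUnit V
  counit := sigmaCounit V
  -- A point `⟨i, x⟩` is sent to `⟨⋆, ⟨i, x⟩⟩` and then projected back.
  left_triangle _ := rfl
  left_triangle_cell M := heq_of_eq (by
    funext ⟨i, x⟩ ⟨j, y⟩
    refine sigma_ext fun a => ?_
    refine (sigmaInj_cell_assoc _ _ a x y _).trans ?_
    exact congrArg (sigmaInj (famPro M) a x y ≫ ·) (sigmaInj_desc _ _))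
  right_triangle _ := rfl
  right_triangle_cell M := DblFam.cell_heq rfl rfl (fun _ => rfl) fun a => heq_of_eq (by
    funext x y
    exact sigmaInj_desc _ _)

end SigmaFunctor

end VMat

/-! ### Universal properties of the coprojections -/

namespace ColaxAdjunction

variable {D : DblCat.{u, v, p, c}} {S : ColaxFunctor (DblFam.{w} D) D}
  (adj : ColaxAdjunction S (DblFam.singleton.{w} D))

/-- A family of arrows with common codomain, as an arrow to a singleton family. -/
abbrev toSingleton {X : FamObj.{w} D} {y : D.Obj} (φ : ∀ i, X.obj i ⟶ y) :
    X ⟶ (DblFam.singletonBase.{w} D).obj y :=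
  FamHom.mk (Y := (DblFam.singletonBase.{w} D).obj y) (fun _ => PUnit.unit) φ

lemma arr_congr {X : FamObj.{w} D} {y : D.Obj} {f g : X ⟶ (DblFam.singletonBase.{w} D).obj y}
    (h : f = g) (i : X.I) : (FamHom.arr f i : X.obj i ⟶ y) = FamHom.arr g i :=
  h ▸ rfl

/-- The arrow out of a coproduct induced by a family of arrows. -/
def objDesc {X : FamObj.{w} D} {y : D.Obj} (φ : ∀ i, X.obj i ⟶ y) : S.base.obj X ⟶ y :=
  S.base.map (toSingleton φ) ≫ adj.counit.base.app y

/-- Naturality of the unit at `toSingleton φ`, followed by the right triangle identity. -/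
lemma objCoproj_desc {X : FamObj.{w} D} {y : D.Obj} (φ : ∀ i, X.obj i ⟶ y) (i : X.I) :
    adj.objCoproj X i ≫ adj.objDesc φ = φ i := by
  have h₁ : FamHom.arr (toSingleton φ) i ≫ adj.objCoproj ((DblFam.singletonBase.{w} D).obj y)
      PUnit.unit = adj.objCoproj X i ≫ S.base.map (toSingleton φ) :=
    arr_congr (y := S.base.obj ((DblFam.singletonBase.{w} D).obj y))
      (adj.unit.base.naturality (toSingleton φ)) i
  have h₂ : adj.objCoproj ((DblFam.singletonBase.{w} D).obj y) PUnit.unit ≫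
      adj.counit.base.app y = 𝟙 y :=
    arr_congr (y := y) (adj.right_triangle y) PUnit.unit
  refine (Category.assoc _ _ _).symm.trans
    ((congrArg (· ≫ adj.counit.base.app y) h₁.symm).trans ((Category.assoc _ _ _).trans ?_))
  exact (congrArg (φ i ≫ ·) h₂).trans (Category.comp_id _)

/-- The family `ι_i ≫ f` is the unit followed by the singleton of `f`; naturality of the counit and
the left triangle identity then recover `f`. -/
lemma objDesc_objCoproj {X : FamObj.{w} D} {y : D.Obj} (f : S.base.obj X ⟶ y) :
    adj.objDesc (fun i => adj.objCoproj X i ≫ f) = f := by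
  have h := S.base.map_comp (adj.unit.base.app X) ((DblFam.singleton.{w} D).base.map f)
  refine (congrArg (· ≫ adj.counit.base.app y) h).trans ((Category.assoc _ _ _).trans ?_)
  refine (congrArg (S.base.map (adj.unit.base.app X) ≫ ·) (adj.counit.base.naturality f)).trans ?_
  refine (Category.assoc _ _ _).symm.trans ((congrArg (· ≫ f) (adj.left_triangle X)).trans ?_)
  exact Category.id_comp _

lemma obj_hom_ext {X : FamObj.{w} D} {y : D.Obj} {f g : S.base.obj X ⟶ y}
    (h : ∀ i, adj.objCoproj X i ≫ f = adj.objCoproj X i ≫ g) : f = g := by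
  rw [← adj.objDesc_objCoproj f, ← adj.objDesc_objCoproj g]
  exact congrArg adj.objDesc (funext h)

/-- The coprojections exhibit the value of a left adjoint as a coproduct. -/
def objIsColimit (X : FamObj.{w} D) :
    IsColimit (Cofan.mk (S.base.obj X) (adj.objCoproj X)) :=
  Cofan.IsColimit.mk _ (fun s => adj.objDesc s.inj) (fun s i => adj.objCoproj_desc s.inj i)
    fun s _ h => adj.obj_hom_ext fun i => (h i).trans (adj.objCoproj_desc s.inj i).symm

/-! ### The universal property of coprojections for cells -/

section Cells

variable {X Y : FamObj.{w} D} {M : FamPro X Y} {x y : D.Obj} {N : D.Pro x y}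
  {f : S.base.obj X ⟶ x} {g : S.base.obj Y ⟶ y}

lemma famCell_congr {h : X ⟶ (DblFam.singletonBase.{w} D).obj x}
    {k : Y ⟶ (DblFam.singletonBase.{w} D).obj y}
    {Θ Θ' : FamCell h k M ((DblFam.singleton.{w} D).pro N)} (e : Θ = Θ') {i : X.I} {j : Y.I}
    (a : M.span.Elt i j) :
    (show D.Cell (x' := x) (y' := y) (FamHom.arr h i) (FamHom.arr k j) (M.pro a) N from Θ.cell a) =
      Θ'.cell a :=
  e ▸ rfl

/-- A cell is recovered from its transpose by naturality of the counit and the left triangle. Since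
the boundaries agree only propositionally, the equation is stated in the category of proarrows,
where no casts are needed. -/
lemma hom_eq_map_comp_counit (α : D.Cell f g (S.pro M) N) :
    DblCat.hom α = DblCat.hom (S.cell ((DblFam.{w} D).vcomp (adj.unit.cell M)
      ((DblFam.singleton.{w} D).cell α))) ≫ DblCat.hom (adj.counit.cell N) := by
  have h₁ := DblCat.hom_congr (adj.left_triangle X) (adj.left_triangle Y) (adj.left_triangle_cell M)
  have h₂ := DblCat.hom_congr (adj.counit.base.naturality f) (adj.counit.base.naturality g)
    (adj.counit.cell_naturality α)
  refine Eq.symm ((congrArg (· ≫ DblCat.hom (adj.counit.cell N)) (S.hom_cell_vcomp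
    (adj.unit.cell M) ((DblFam.singleton.{w} D).cell α))).trans ((Category.assoc _ _ _).trans ?_))
  refine (congrArg (DblCat.hom (S.cell (adj.unit.cell M)) ≫ ·) (h₂.trans (DblCat.hom_vcomp _ _))).trans
    ((Category.assoc _ _ _).symm.trans ?_)
  exact (congrArg (· ≫ DblCat.hom α) h₁).trans (Category.id_comp _)

lemma cell_hom_ext {α β : D.Cell f g (S.pro M) N}
    (h : ∀ {i j} (a : M.span.Elt i j),
      D.vcomp (adj.proCoproj M a) α = D.vcomp (adj.proCoproj M a) β) : α = β := by
  apply eq_of_heq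
  apply DblCat.heq_of_hom
  rw [adj.hom_eq_map_comp_counit α, adj.hom_eq_map_comp_counit β]
  congr 3
  -- Only the transposes remain to be compared. They index into a one-element span, so they agree as
  -- soon as their members do.
  exact eq_of_heq (DblFam.cell_heq rfl rfl (fun _ => rfl) fun a => heq_of_eq (h _))

lemma exists_cell_desc
    (θ : ∀ {i j} (a : M.span.Elt i j),
      D.Cell (adj.objCoproj X i ≫ f) (adj.objCoproj Y j ≫ g) (M.pro a) N) :
    ∃ α : D.Cell f g (S.pro M) N,
      ∀ {i j} (a : M.span.Elt i j), D.vcomp (adj.proCoproj M a) α = θ a := by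
  let Θ : FamCell (adj.unit.base.app X ≫ (DblFam.singletonBase.{w} D).map f)
      (adj.unit.base.app Y ≫ (DblFam.singletonBase.{w} D).map g) M
      ((DblFam.singleton.{w} D).pro N) :=
    ⟨⟨fun _ => PUnit.unit, fun _ => rfl, fun _ => rfl⟩, fun a => θ a⟩
  -- The transpose of `Θ` has as sides the arrows induced by the families `ι_i ≫ f` and `ι_j ≫ g`;
  -- these equal `f` and `g` only by uniqueness of induced arrows, hence the cast.
  refine ⟨DblCat.castCell (adj.objDesc_objCoproj f) (adj.objDesc_objCoproj g)
    (D.vcomp (S.cell Θ) (adj.counit.cell N)), fun {i j} a => ?_⟩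
  let α := D.vcomp (S.cell Θ) (adj.counit.cell N)
  -- Transposing back returns `Θ`, by naturality of the unit (`h₁`) and the right triangle (`h₂`);
  -- `h₃` discards the cast.
  have key : (DblFam.{w} D).vcomp (adj.unit.cell M) ((DblFam.singleton.{w} D).cell
      (DblCat.castCell (adj.objDesc_objCoproj f) (adj.objDesc_objCoproj g)
        (D.vcomp (S.cell Θ) (adj.counit.cell N)))) = Θ := by
    apply eq_of_heq
    apply DblCat.heq_of_hom (D := DblFam.{w} D)
    have h₁ := DblCat.hom_congr (D := DblFam.{w} D)
      (adj.unit.base.naturality _) (adj.unit.base.naturality _) (adj.unit.cell_naturality Θ)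
    have h₂ := DblCat.hom_congr (D := DblFam.{w} D)
      (adj.right_triangle x) (adj.right_triangle y) (adj.right_triangle_cell N)
    have h₃ : DblCat.hom (D := DblFam.{w} D) ((DblFam.singleton.{w} D).cell
        (DblCat.castCell (adj.objDesc_objCoproj f) (adj.objDesc_objCoproj g) α)) =
        DblCat.hom (D := DblFam.{w} D) ((DblFam.singleton.{w} D).cell α) :=
      DblCat.hom_congr (congrArg (DblFam.singleton.{w} D).base.map (adj.objDesc_objCoproj f).symm)
        (congrArg (DblFam.singleton.{w} D).base.map (adj.objDesc_objCoproj g).symm)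
        ((DblFam.singleton.{w} D).cell_congr (adj.objDesc_objCoproj f).symm
          (adj.objDesc_objCoproj g).symm (DblCat.castCell_heq _ _ _))
    refine (congrArg (DblCat.hom (D := DblFam.{w} D) (adj.unit.cell M) ≫ ·) (h₃.trans
      ((DblFam.singleton.{w} D).hom_cell_vcomp (S.cell Θ) (adj.counit.cell N)))).trans ?_
    refine (Category.assoc _ _ _).symm.trans ((congrArg (· ≫ DblCat.hom (D := DblFam.{w} D)
      ((DblFam.singleton.{w} D).cell (adj.counit.cell N))) (h₁.trans (DblCat.hom_vcomp _ _)).symm).trans ?_)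
    refine (Category.assoc _ _ _).trans ((congrArg (DblCat.hom (D := DblFam.{w} D) Θ ≫ ·)
      ((DblCat.hom_vcomp _ _).symm.trans h₂)).trans (Category.comp_id _))
  exact famCell_congr key a

end Cells

end ColaxAdjunction

/-! ### From whole matrices to single entries -/

namespace VMat

variable {V : Type u} [Category.{v} V]

open Classical in
-- The hypotheses `ext` and `desc` describe maps out of the whole matrix `R`. They are tested on
-- matrices that agree with `R` except at `(f i x, g j y)`, where the entry is an arbitrary `Z`.
-- Injectivity ensures that no other `M_{a'}(x', y')` is sent to that entry.
lemma isColimit_cofan_of_cells {I J P Q : Type w} {X : I → Type w} {Y : J → Type w}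
    {A : SetSpan I J} {M : SpanFam V X Y A} {R : P → Q → V}
    {f : ∀ i, X i → P} {g : ∀ j, Y j → Q}
    (hf : Function.Injective fun p : Σ i, X i => f p.1 p.2)
    (hg : Function.Injective fun q : Σ j, Y j => g q.1 q.2)
    (r : ∀ ⦃i j⦄ (a : A.Elt i j) (x : X i) (y : Y j), M a x y ⟶ R (f i x) (g j y))
    (ext : ∀ (N : P → Q → V) (α β : ∀ p q, R p q ⟶ N p q),
      (∀ ⦃i j⦄ (a : A.Elt i j) x y, r a x y ≫ α _ _ = r a x y ≫ β _ _) → α = β)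
    (desc : ∀ (N : P → Q → V) (θ : ∀ ⦃i j⦄ (a : A.Elt i j) x y, M a x y ⟶ N (f i x) (g j y)),
      ∃ α : ∀ p q, R p q ⟶ N p q, ∀ ⦃i j⦄ (a : A.Elt i j) x y, r a x y ≫ α _ _ = θ a x y)
    {i : I} {j : J} (x : X i) (y : Y j) :
    Nonempty (IsColimit (Cofan.mk (R (f i x) (g j y)) fun a : A.Elt i j => r a x y)) := by
  let N (Z : V) (p : P) (q : Q) : V := if p = f i x ∧ q = g j y then Z else R p q
  have e₁ (Z : V) {p q} (h : p = f i x ∧ q = g j y) : N Z p q = Z := if_pos h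
  have e₂ (Z : V) {p q} (h : ¬ (p = f i x ∧ q = g j y)) : N Z p q = R p q := if_neg h
  have hfg {i' j' x' y'} (h : f i' x' = f i x ∧ g j' y' = g j y) :
      (⟨i', x'⟩ : Σ i, X i) = ⟨i, x⟩ ∧ (⟨j', y'⟩ : Σ j, Y j) = ⟨j, y⟩ := ⟨hf h.1, hg h.2⟩
  have ext' {Z : V} {s t : R (f i x) (g j y) ⟶ Z}
      (h : ∀ a : A.Elt i j, r a x y ≫ s = r a x y ≫ t) : s = t := by
    -- Extend `s` by the identity at all other entries, so that `E s` and `E t` can differ only at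
    -- the chosen one.
    let E (s : R (f i x) (g j y) ⟶ Z) (p q) : R p q ⟶ N Z p q :=
      if h : p = f i x ∧ q = g j y then
        eqToHom (by rw [h.1, h.2]) ≫ s ≫ eqToHom (e₁ Z h).symm
      else eqToHom (e₂ Z h).symm
    have := congrFun (congrFun (ext (N Z) (E s) (E t) fun i' j' a x' y' => ?_) (f i x)) (g j y)
    · exact (cancel_mono (eqToHom (e₁ Z ⟨rfl, rfl⟩).symm)).1 (by simpa [E] using this)
    · by_cases h' : f i' x' = f i x ∧ g j' y' = g j y
      · obtain ⟨h₁, h₂⟩ := hfg h'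
        cases h₁
        cases h₂
        simp only [E, dif_pos h', eqToHom_refl, Category.id_comp]
        rw [reassoc_of% h]
      · simp only [E, dif_neg h']
  have desc' (Z : V) (φ : ∀ a : A.Elt i j, M a x y ⟶ Z) :
      ∃ s : R (f i x) (g j y) ⟶ Z, ∀ a : A.Elt i j, r a x y ≫ s = φ a := by
    -- `φ` is given only at `(i, x)` and `(j, y)`. Taking the equalities of points as arguments
    -- transports it to the indices found by injectivity, and it reduces to `φ` when they are
    -- reflexive.
    let φ' (p : Σ i, X i) (q : Σ j, Y j) (hp : p = ⟨i, x⟩) (hq : q = ⟨j, y⟩)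
        (a : A.Elt p.1 q.1) : M a p.2 q.2 ⟶ Z := by
      subst hp hq
      exact φ a
    -- Away from the chosen entry the target is `R` itself, and the cocone `r` supplies the missing
    -- maps.
    let θ ⦃i' j'⦄ (a : A.Elt i' j') x' y' : M a x' y' ⟶ N Z (f i' x') (g j' y') :=
      if h : f i' x' = f i x ∧ g j' y' = g j y then
        φ' ⟨i', x'⟩ ⟨j', y'⟩ (hfg h).1 (hfg h).2 a ≫ eqToHom (e₁ Z h).symm
      else r a x' y' ≫ eqToHom (e₂ Z h).symm
    obtain ⟨α, hα⟩ := desc (N Z) θ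
    refine ⟨α _ _ ≫ eqToHom (e₁ Z ⟨rfl, rfl⟩), fun a => ?_⟩
    have hθ : θ a x y = φ a ≫ eqToHom (e₁ Z ⟨rfl, rfl⟩).symm :=
      dif_pos (c := f i x = f i x ∧ g j y = g j y) ⟨rfl, rfl⟩
    rw [← Category.assoc, hα, hθ, Category.assoc, eqToHom_trans, eqToHom_refl, Category.comp_id]
  choose d hd using desc'
  exact ⟨Cofan.IsColimit.mk _ (fun s => d _ s.inj) (fun s a => hd _ s.inj a)
    fun s _ h => ext' fun a => (h a).trans (hd _ s.inj a).symm⟩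

variable [MonoidalCategory V] [DistributiveMonoidal.{w} V]

/-- The arrow induced by the inclusions into the concrete disjoint union is a left inverse. -/
lemma objCoproj_injective {S : ColaxFunctor (DblFam.{w} (VMat.{w} V)) (VMat.{w} V)}
    (adj : ColaxAdjunction S (DblFam.singleton.{w} (VMat.{w} V))) (X : FamObj.{w} (VMat.{w} V)) :
    Function.Injective fun p : Σ i, Carrier (X.obj i) => fn (adj.objCoproj X p.1) p.2 := by
  let k : S.base.obj X ⟶ (sigmaBase V).obj X := adj.objDesc fun i =>
    (TypeCat.ofHom (fun x => ⟨i, x⟩ : Carrier (X.obj i) → Σ i, Carrier (X.obj i)) : _ ⟶ _)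
  refine Function.LeftInverse.injective (g := fn k) fun p => ?_
  exact congrArg (fun f => fn f p.2) (adj.objCoproj_desc (fun i =>
    (TypeCat.ofHom (fun x => ⟨i, x⟩ : Carrier (X.obj i) → Σ i, Carrier (X.obj i)) : _ ⟶ _)) p.1)

end VMat

theorem mainTheorem7 (V : Type u) [Category.{v} V] [MonoidalCategory V] [SymmetricCategory V]
    [DistributiveMonoidal.{w} V] :
    DblCat.HasStrongCoproducts.{w} (VMat.{w} V) ∧
      ∀ (S : ColaxFunctor (DblFam.{w} (VMat.{w} V)) (VMat.{w} V))
        (adj : ColaxAdjunction S (DblFam.singleton.{w} (VMat.{w} V))),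
        (∀ X : FamObj.{w} (VMat.{w} V),
          Nonempty (IsColimit (Cofan.mk (S.base.obj X) (adj.objCoproj X)))) ∧
        ∀ (X Y : FamObj.{w} (VMat.{w} V)) (M : FamPro X Y) (i : X.I) (j : Y.I)
          (x : VMat.Carrier (X.obj i)) (y : VMat.Carrier (Y.obj j)),
          Nonempty (IsColimit (Cofan.mk
            (VMat.entry (S.pro M) (VMat.fn (adj.objCoproj X i) x) (VMat.fn (adj.objCoproj Y j) y))
            fun a : M.span.Elt i j => VMat.cellEntry (adj.proCoproj M a) x y)) := by
  refine ⟨⟨VMat.sigma V, VMat.sigma_isPseudo V, ⟨VMat.sigmaAdjunction V⟩⟩,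
    fun S adj => ⟨fun X => ⟨adj.objIsColimit X⟩, fun X Y M i j x y => ?_⟩⟩
  refine VMat.isColimit_cofan_of_cells (M := VMat.famPro M) (VMat.objCoproj_injective adj X)
    (VMat.objCoproj_injective adj Y) (fun _ _ a x y => VMat.cellEntry (adj.proCoproj M a) x y)
    (fun N α β h => ?_) (fun N θ => ?_) x y
  -- Cells with identity sides are exactly families of maps between entries at the same indices, and
  -- a coprojection followed by an identity function is definitionally itself.
  · refine adj.cell_hom_ext (N := N) (f := 𝟙 _) (g := 𝟙 _) fun a => ?_
    funext x y
    exact h a x y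
  · obtain ⟨α, hα⟩ := adj.exists_cell_desc (N := N) (f := 𝟙 _) (g := 𝟙 _) (M := M)
      fun a x y => θ a x y
    exact ⟨α, fun _ _ a x y => congrFun (congrFun (hα a) x) y⟩
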